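/- Let $\mathcal A=\{\mathtt u,\mathtt d\}$, coded as $\mathtt u=1$, $\mathtt d=-1$, and let $\alpha^{\ell}_n\in[0,1]$ for $\ell\in\mathcal A$ and $n\in\{1,2,\dots\}\cup\{\infty\}$. Let $(U_n)_{n\ge 0}$ be a Markov chain of left-infinite words over $\mathcal A$, with any initial distribution, which evolves as follows: given $U_0,\dots,U_n$, if the last run of equal letters of $U_n$ consists of $k\in\{1,2,\dots\}\cup\{\infty\}$ letters $\ell$, then $U_{n+1}$ is $U_n$ followed on the right by the letter other than $\ell$ with probability $\alpha^\ell_k$, and $U_n$ followed by $\ell$ with probability $1-\alpha^\ell_k$. Let $X_n$ be the last letter of $U_n$, and let $S_0=0$, $S_n=X_1+\dots+X_n$ be the associated persistent random walk. For $\ell\in\mathcal A$ and $n\ge1$ put $$\mathcal T_\ell(n)=\prod_{k=1}^{n-1}(1-\alpha^\ell_k),\qquad \Theta_\ell(\infty)=\sum_{n=1}^{\infty}\mathcal T_\ell(n)\in[1,\infty],$$ the distribution tail $\mathbb P(\tau^\ell\ge n)$ and the mean of the length $\tau^\ell$ of a run of letters $\ell$. Assume that - for each $\ell\in\mathcal A$,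 $\alpha^\ell_\infty\neq0$ and $\prod_{k=r}^\infty(1-\alpha^\ell_k)=0$ for all $r\ge1$; - the run lengths $\tau^{\mathtt u}$ and $\tau^{\mathtt d}$ are not both almost surely constant, where $\tau^\ell$ is almost surely constant if $\mathcal T_\ell(a)=1$ and $\mathcal T_\ell(a+1)=0$ for some integer $a\ge1$; - the event $\{(X_0,X_1)=(\mathtt u,\mathtt d)\}$ has positive probability. All statements below are under the conditional probability given this event; - at least one of $\Theta_{\mathtt u}(\infty)$, $\Theta_{\mathtt d}(\infty)$ is finite. Let $$\mathbf d_S=\frac{\Theta_{\mathtt u}(\infty)-\Theta_{\mathtt d}(\infty)}{\Theta_{\mathtt u}(\infty)+\Theta_{\mathtt d}(\infty)},$$ with $\mathbf d_S=1$ if $\Theta_{\mathtt u}(\infty)=\infty$ and $\mathbf d_S=-1$ if $\Theta_{\mathtt d}(\infty)=\infty$. Then $S$ is recurrent (for every $x\in\mathbb Z$, almost surely $S_n=x$ for infinitely many $n$) if and only if $\mathbf d_S=0$, and $S$ is transient (almost surely $\lim_{n\to\infty}|S_n|=\infty$) if and only if $\mathbf d_S\ne0$. Moreover $\mathbf d_S\in[-1,1]$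 and $$\lim_{n\to\infty}\frac{S_n}{n}=\mathbf d_S\quad\text{almost surely.}$$ -/

import Mathlib

open MeasureTheory ProbabilityTheory Filter Topology
open scoped ENNReal

namespace PersistentWalk

/-- The two-letter alphabet: `u` for a rise, `d` for a descent. -/
abbrev Letter : Type := Bool

abbrev u : Letter := true

abbrev d : Letter := false

/-- The coding of the letters as the jumps `1` (rise) and `-1` (descent). -/
def jump (l : Letter) : ℤ := if l = u then 1 else -1

/-- Left-infinite words `⋯ w₂ w₁ w₀`. The letter `w 0` is the rightmost one, and `w k` is the letter
`k` places to its left. They carry the product σ-algebra. -/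
abbrev LeftWord : Type := ℕ → Letter

/-- The word `w l` obtained by adding the letter `l` at the right end of `w`. -/
def snoc (w : LeftWord) (l : Letter) : LeftWord
  | 0 => l
  | k + 1 => w k

/-- The length, in `{1, 2, …, ∞}`, of the last run of the word `w`: the largest number of letters at
its right end that are all equal to its last letter. Together with the last letter `l = w 0` it
determines the context of `w` in the double infinite comb: this is `lⁿ l'` (where `l' ≠ l`) if the
length is `n < ∞`, and `l^∞` if it is `∞`. -/
noncomputable def runLength (w : LeftWord) : ℕ∞ :=
  ⨅ (n : ℕ) (_ : w n ≠ w 0), (n : ℕ∞)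

/-- The probability, attached to the context of the word `w`, that the next letter is `l`. The number
`α l n` is the probability of changing letter after a run of length `n ∈ {1, 2, …, ∞}` of
letters `l`; the value `α l 0` is never used. -/
noncomputable def nextProb (α : Letter → ℕ∞ → ℝ) (w : LeftWord) (l : Letter) : ℝ :=
  if l = w 0 then 1 - α (w 0) (runLength w) else α (w 0) (runLength w)

/-- `U` is a variable length Markov chain on the double infinite comb with probabilities of change
`α`, under `P` and with an arbitrary initial distribution: given `U 0, …, U n`, the word `U (n + 1)`
is `U n` followed by the letter `l` with the probability attached to the context of `U n`. -/
structure IsVLMC {Ω : Type*} [MeasurableSpace Ω] (α : Letter → ℕ∞ → ℝ) (P : Measure Ω)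
    (U : ℕ → Ω → LeftWord) : Prop where
  measurable : ∀ n, Measurable (U n)
  transition : ∀ (n : ℕ) (l : Letter),
    P⟦{ω | U (n + 1) ω = snoc (U n ω) l} | ⨆ k ≤ n, MeasurableSpace.comap (U k) inferInstance⟧
      =ᵐ[P] fun ω => nextProb α (U n ω) l

/-- The letter process: `X n` is the rightmost letter of `U n`. -/
def letter {Ω : Type*} (U : ℕ → Ω → LeftWord) (n : ℕ) (ω : Ω) : Letter := U n ω 0

/-- The persistent random walk `S n = X 1 + ⋯ + X n`, with `S 0 = 0`. -/
def walk {Ω : Type*} (U : ℕ → Ω → LeftWord) (n : ℕ) (ω : Ω) : ℤ :=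
  ∑ k ∈ Finset.Icc 1 n, jump (letter U k ω)

/-- The event `(X 0, X 1) = (u, d)` that the initial time is an up-down breaking time. -/
def upDownAtZero {Ω : Type*} (U : ℕ → Ω → LeftWord) : Set Ω :=
  {ω | letter U 0 ω = u ∧ letter U 1 ω = d}

/-- The probabilities of change are admissible: runs are almost surely finite. -/
def Admissible (α : Letter → ℕ∞ → ℝ) : Prop :=
  ∀ l : Letter, α l ⊤ ≠ 0 ∧ ∀ r : ℕ, 1 ≤ r →
    Tendsto (fun N : ℕ => ∏ k ∈ Finset.Ico r N, (1 - α l k)) atTop (𝓝 0)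

/-- The distribution tail `P(τ ≥ n) = ∏_{k=1}^{n-1} (1 - α l k)`, `n ≥ 1`, of the length `τ` of a run
of letters `l`. -/
noncomputable def tail (α : Letter → ℕ∞ → ℝ) (l : Letter) (n : ℕ) : ℝ :=
  ∏ k ∈ Finset.Ico 1 n, (1 - α l k)

/-- The mean length `∑_{n ≥ 1} P(τ ≥ n) ∈ [1, ∞]` of a run of letters `l`. -/
noncomputable def meanRun (α : Letter → ℕ∞ → ℝ) (l : Letter) : ℝ≥0∞ :=
  ∑' n : ℕ, ENNReal.ofReal (tail α l (n + 1))

/-- The length `τ` of a run of letters `l` is almost surely constant: for some `a ≥ 1`,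
`P(τ ≥ a) = 1` and `P(τ ≥ a + 1) = 0`. -/
def ConstantRun (α : Letter → ℕ∞ → ℝ) (l : Letter) : Prop :=
  ∃ a : ℕ, 1 ≤ a ∧ tail α l a = 1 ∧ tail α l (a + 1) = 0

/-- The drift `(Θ_u - Θ_d) / (Θ_u + Θ_d)` where `Θ_l` is the mean length of a run of letters `l`,
extended by continuity: it is `1` if `Θ_u = ∞ > Θ_d`, and `-1` if `Θ_d = ∞ > Θ_u`. (It is not meant
to be used if both means are infinite.) -/
noncomputable def drift (α : Letter → ℕ∞ → ℝ) : ℝ :=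
  if meanRun α u = ∞ then 1
  else if meanRun α d = ∞ then -1
  else ((meanRun α u).toReal - (meanRun α d).toReal) /
    ((meanRun α u).toReal + (meanRun α d).toReal)

/-- Recurrence of a process on `ℤ`: every `x` is almost surely visited at arbitrarily large times. -/
def Recurrent {Ω : Type*} [MeasurableSpace Ω] (Q : Measure Ω) (S : ℕ → Ω → ℤ) : Prop :=
  ∀ x : ℤ, ∀ᵐ ω ∂Q, ∃ᶠ n in atTop, S n ω = x

/-- Transience of a process on `ℤ`: almost surely `|S n| → ∞`. -/
def Transient {Ω : Type*} [MeasurableSpace Ω] (Q : Measure Ω) (S : ℕ → Ω → ℤ) : Prop :=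
  ∀ᵐ ω ∂Q, Tendsto (fun n => |S n ω|) atTop atTop

end PersistentWalk

/-!
The letters from time `1` on split into runs, which alternate between descents and rises. Since the
probabilities of change only depend on the letter and the length of the current run, the conditional
law given `(X 0, X 1) = (u, d)` makes the run lengths independent, alternately distributed as the
runs of descents and the runs of rises (`IsVLMC.map_runLen`). To see this, it suffices to bound from
below the probability of each value of the first run lengths by the product of the probabilities of
the single lengths (`IsVLMC.exists_runs`): these products add up to one, because runs are almost
surely finite.

For the limit of `S n / n`, let `D j` and `E j` be the total lengths of the first `j` runs of
descents and of rises. By the strong law, and by truncation where a mean is infinite, `D j / j` and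
`E j / j` tend to the mean lengths `Θ_d` and `Θ_u`. Among the times up to `D j + E j` there are
`D j` descents and `E j` rises. As the number of descents up to time `n` is monotone in `n`, its
growth rate is the one along these times, namely `Θ_d / (Θ_u + Θ_d)`, and `S n / n` tends to the
drift (`tendsto_div_of_subseq`, `IsVLMC.tendsto_walk_div`). Hence `|S n| → ∞` if the drift is
nonzero.

If the drift is zero, both means are finite and equal, and `S` takes at the times `D j + E j` the
values `E j - D j` of a random walk with centred steps, which are not almost surely zero since the
run lengths are not both constant. Such a walk is unbounded above and below (`ae_unbounded_sum`).
Indeed, let `W` be the supremum of its partial sums and `W'` the supremum of the partial sums after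
the first step `Y`. They have the same law and, where they are finite, `W - W' = max (-W') Y ≥ Y`.
The difference has mean zero, as `Y` has, so that `W = W' + Y` (`ae_toReal_supSum_eq`); by the
independence of `W'` and `Y`, with positive probability `Y` would make `W` smaller than its least
possible value. So `W` is infinite. As `S` moves by steps `1` and `-1`, it takes every value
infinitely often.
-/

namespace PersistentWalk

/-! ### Run lengths of words and their laws -/

lemma runLength_snoc_of_ne {w : LeftWord} {l : Letter} (h : l ≠ w 0) :
    runLength (snoc w l) = 1 := by
  refine le_antisymm (iInf₂_le_of_le 1 (by simpa [snoc] using h.symm) (by simp)) ?_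
  refine le_iInf₂ fun n hn => ?_
  rcases n with _ | n
  · simp at hn
  · exact_mod_cast Nat.succ_le_succ (Nat.zero_le n)

lemma runLength_snoc_self (w : LeftWord) :
    runLength (snoc w (w 0)) = runLength w + 1 := by
  refine le_antisymm ?_ ?_
  · by_cases h : ∃ n, w n ≠ w 0
    · obtain ⟨n, hn, hrun⟩ : ∃ n, w n ≠ w 0 ∧ runLength w = n := by
        classical
        refine ⟨Nat.find h, Nat.find_spec h,
          le_antisymm (iInf₂_le (Nat.find h) (Nat.find_spec h)) ?_⟩
        exact le_iInf₂ fun n hn => by exact_mod_cast Nat.find_min' h hn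
      rw [hrun]
      exact iInf₂_le_of_le (n + 1) (by simpa [snoc] using hn) (by simp)
    · push Not at h
      have : runLength w = ⊤ := by simp [runLength, h]
      simp [this]
  · refine le_iInf₂ fun n hn => ?_
    rcases n with _ | n
    · simp at hn
    · have : runLength w ≤ n := iInf₂_le n (by simpa [snoc] using hn)
      push_cast
      gcongr

lemma nextProb_add (α : Letter → ℕ∞ → ℝ) (w : LeftWord) :
    nextProb α w (w 0) + nextProb α w (!w 0) = 1 := by
  simp [nextProb]

/-- The probability `P(τ ≥ n) - P(τ ≥ n + 1)` that a run of letters `l` has length `n`. -/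
noncomputable def runProb (α : Letter → ℕ∞ → ℝ) (l : Letter) (n : ℕ) : ℝ :=
  tail α l n - tail α l (n + 1)

/-- The law, on `ℕ`, of the length of a run of letters `l`. -/
noncomputable def runLaw (α : Letter → ℕ∞ → ℝ) (l : Letter) : Measure ℕ :=
  Measure.sum fun n => ENNReal.ofReal (runProb α l n) • Measure.dirac n

lemma runLaw_singleton (α : Letter → ℕ∞ → ℝ) (l : Letter) (n : ℕ) :
    runLaw α l {n} = ENNReal.ofReal (runProb α l n) :=
  Measure.sum_smul_dirac_singleton

@[simp] lemma tail_zero (α : Letter → ℕ∞ → ℝ) (l : Letter) : tail α l 0 = 1 := by simp [tail]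

@[simp] lemma tail_one (α : Letter → ℕ∞ → ℝ) (l : Letter) : tail α l 1 = 1 := by simp [tail]

lemma tail_add_two (α : Letter → ℕ∞ → ℝ) (l : Letter) (n : ℕ) :
    tail α l (n + 2) = tail α l (n + 1) * (1 - α l (n + 1 : ℕ)) := by
  simp only [tail]
  rw [Finset.prod_Ico_succ_top (by omega)]

lemma runProb_zero (α : Letter → ℕ∞ → ℝ) (l : Letter) : runProb α l 0 = 0 := by simp [runProb]

lemma runProb_succ (α : Letter → ℕ∞ → ℝ) (l : Letter) (n : ℕ) :
    runProb α l (n + 1) = tail α l (n + 1) * α l (n + 1 : ℕ) := by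
  rw [runProb, tail_add_two]; ring

section Law

variable {α : Letter → ℕ∞ → ℝ}

lemma tail_nonneg (hα : ∀ l : Letter, ∀ n : ℕ∞, 1 ≤ n → α l n ∈ Set.Icc (0 : ℝ) 1)
    (l : Letter) (n : ℕ) : 0 ≤ tail α l n := by
  refine Finset.prod_nonneg fun k hk => ?_
  have := (hα l k (by exact_mod_cast (Finset.mem_Ico.1 hk).1)).2
  linarith

lemma runProb_nonneg (hα : ∀ l : Letter, ∀ n : ℕ∞, 1 ≤ n → α l n ∈ Set.Icc (0 : ℝ) 1)
    (l : Letter) (n : ℕ) : 0 ≤ runProb α l n := by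
  rcases n with _ | n
  · exact (runProb_zero α l).ge
  · rw [runProb_succ]
    exact mul_nonneg (tail_nonneg hα l _) (hα l _ (by exact_mod_cast Nat.succ_pos n)).1

lemma tendsto_tail (hadm : Admissible α) (l : Letter) :
    Tendsto (tail α l) atTop (𝓝 0) := (hadm l).2 1 le_rfl

lemma runLaw_Ici (hα : ∀ l : Letter, ∀ n : ℕ∞, 1 ≤ n → α l n ∈ Set.Icc (0 : ℝ) 1)
    (hadm : Admissible α) (l : Letter) (n : ℕ) :
    runLaw α l (Set.Ici n) = ENNReal.ofReal (tail α l n) := by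
  have hsum : HasSum (fun k => runProb α l (k + n)) (tail α l n) := by
    rw [hasSum_iff_tendsto_nat_of_nonneg fun k => runProb_nonneg hα l _]
    have h : ∀ N, ∑ k ∈ Finset.range N, runProb α l (k + n) = tail α l n - tail α l (N + n) := by
      intro N
      have := Finset.sum_range_sub' (fun k => tail α l (k + n)) N
      simp only [zero_add] at this
      rw [← this]
      refine Finset.sum_congr rfl fun k _ => ?_
      rw [runProb]; congr 2; ring
    simp_rw [h]
    have := (tendsto_tail hadm l).comp (tendsto_add_atTop_nat n)
    simpa using tendsto_const_nhds.sub this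
  have hIci : Set.Ici n = ⋃ k : ℕ, {k + n} := by
    ext m
    simp only [Set.mem_Ici, Set.mem_iUnion, Set.mem_singleton_iff]
    exact ⟨fun h => ⟨m - n, by omega⟩, by rintro ⟨k, rfl⟩; omega⟩
  rw [hIci, measure_iUnion _ fun k => measurableSet_singleton _]
  · simp_rw [runLaw_singleton]
    rw [← ENNReal.ofReal_tsum_of_nonneg (fun k => runProb_nonneg hα l _) hsum.summable,
      hsum.tsum_eq]
  · intro i j hij
    simpa [Function.onFun] using hij

lemma isProbabilityMeasure_runLaw
    (hα : ∀ l : Letter, ∀ n : ℕ∞, 1 ≤ n → α l n ∈ Set.Icc (0 : ℝ) 1)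
    (hadm : Admissible α) (l : Letter) : IsProbabilityMeasure (runLaw α l) := by
  constructor
  have := runLaw_Ici hα hadm l 0
  rwa [show Set.Ici (0 : ℕ) = Set.univ from Set.Ici_bot, tail_zero, ENNReal.ofReal_one] at this

/-- The tail formula `E τ = ∑ P(τ > n)`. -/
lemma lintegral_runLaw (hα : ∀ l : Letter, ∀ n : ℕ∞, 1 ≤ n → α l n ∈ Set.Icc (0 : ℝ) 1)
    (hadm : Admissible α) (l : Letter) :
    ∫⁻ n, (n : ℝ≥0∞) ∂(runLaw α l) = meanRun α l := by
  have h : ∀ n : ℕ, (n : ℝ≥0∞) = ∑' k : ℕ, (Set.Ici (k + 1)).indicator 1 n := by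
    intro n
    rw [tsum_eq_sum (s := Finset.range n)]
    · rw [Finset.sum_congr rfl (g := fun _ => 1)]
      · simp
      · intro k hk
        have := Finset.mem_range.1 hk
        simp [Set.indicator]; omega
    · intro k hk
      simp at hk
      simp [Set.indicator]; omega
  simp_rw [h]
  rw [lintegral_tsum fun k => (measurable_of_countable _).aemeasurable]
  refine tsum_congr fun k => ?_
  rw [lintegral_indicator_one (measurableSet_Ici), runLaw_Ici hα hadm]

lemma one_le_meanRun (α : Letter → ℕ∞ → ℝ) (l : Letter) : 1 ≤ meanRun α l := by
  refine le_trans ?_ (ENNReal.le_tsum 0)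
  simp

/-- A run length which is almost surely equal to a constant is constant in the sense of its
distribution tail. -/
lemma constantRun_of_ae_eq (hα : ∀ l : Letter, ∀ n : ℕ∞, 1 ≤ n → α l n ∈ Set.Icc (0 : ℝ) 1)
    (hadm : Admissible α) (l : Letter) (a : ℕ) (h : ∀ᵐ n ∂(runLaw α l), n = a) :
    ConstantRun α l := by
  have := isProbabilityMeasure_runLaw hα hadm l
  have h1 : runLaw α l (Set.Ici a) = 1 := by
    rw [prob_compl_eq_zero_iff (measurableSet_Ici) |>.symm]
    refine measure_mono_null (fun n hn => ?_) h
    simp at hn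
    simp; omega
  have h2 : runLaw α l (Set.Ici (a + 1)) = 0 := by
    refine measure_mono_null (fun n hn => ?_) h
    simp at hn
    simp; omega
  rw [runLaw_Ici hα hadm] at h1 h2
  have h2' : tail α l (a + 1) = 0 :=
    le_antisymm (ENNReal.ofReal_eq_zero.1 h2) (tail_nonneg hα l _)
  have h1' : tail α l a = 1 := by simpa using h1
  refine ⟨a, ?_, h1', h2'⟩
  rcases a with _ | a
  · simp at h2'
  · omega

end Law

/-! ### The law of a run of the chain -/

section Chain

variable {Ω : Type*}

/-- The σ-algebra generated by `U 0, …, U n`. -/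
abbrev past (U : ℕ → Ω → LeftWord) (n : ℕ) : MeasurableSpace Ω :=
  ⨆ k ≤ n, MeasurableSpace.comap (U k) inferInstance

lemma past_mono (U : ℕ → Ω → LeftWord) {m n : ℕ} (h : m ≤ n) : past U m ≤ past U n :=
  iSup₂_le fun k hk => le_iSup₂_of_le k (hk.trans h) le_rfl

lemma measurable_past (U : ℕ → Ω → LeftWord) {k n : ℕ} (h : k ≤ n) :
    Measurable[past U n] (U k) :=
  Measurable.of_comap_le (le_iSup₂_of_le k h le_rfl)

lemma measurableSet_past_snoc (U : ℕ → Ω → LeftWord) (n : ℕ) (l : Letter) :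
    MeasurableSet[past U (n + 1)] {ω | U (n + 1) ω = snoc (U n ω) l} := by
  have h1 : ∀ i, Measurable[past U (n + 1)] fun ω => U (n + 1) ω i := fun i =>
    (measurable_pi_apply i).comp (measurable_past U le_rfl)
  have h2 : ∀ i, Measurable[past U (n + 1)] fun ω => snoc (U n ω) l i := by
    intro i
    rcases i with _ | i
    · exact measurable_const
    · exact (measurable_pi_apply i).comp (measurable_past U (Nat.le_succ n))
  have : {ω | U (n + 1) ω = snoc (U n ω) l} = ⋂ i, {ω | U (n + 1) ω i = snoc (U n ω) l i} := by
    ext ω; simp [funext_iff]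
  rw [this]
  refine MeasurableSet.iInter fun i => ?_
  exact measurableSet_eq_fun (h1 i) (h2 i)

variable [MeasurableSpace Ω] {α : Letter → ℕ∞ → ℝ} {P : Measure Ω} {U : ℕ → Ω → LeftWord}

lemma IsVLMC.past_le (hU : IsVLMC α P U) (n : ℕ) : past U n ≤ ‹MeasurableSpace Ω› :=
  iSup₂_le fun k _ => (hU.measurable k).comap_le

variable [IsProbabilityMeasure P]

/-- The transition rule, integrated over an event of the past on which the probability that the
letter `l` comes next is a constant `c`. -/
lemma IsVLMC.measure_inter_snoc (hU : IsVLMC α P U) {n : ℕ} {A : Set Ω}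
    (hA : MeasurableSet[past U n] A) (l : Letter) {c : ℝ}
    (hc : ∀ ω ∈ A, nextProb α (U n ω) l = c) :
    P (A ∩ {ω | U (n + 1) ω = snoc (U n ω) l}) = P A * ENNReal.ofReal c := by
  set B := {ω | U (n + 1) ω = snoc (U n ω) l} with hB
  have hAm : MeasurableSet A := hU.past_le n A hA
  have hBm : MeasurableSet B := hU.past_le (n + 1) B (measurableSet_past_snoc U n l)
  have h1 := setIntegral_condExp (μ := P) (hU.past_le n)
    (f := B.indicator fun _ => (1 : ℝ)) ((integrable_const 1).indicator hBm) hA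
  have h2 : ∫ ω in A, (P⟦B | past U n⟧) ω ∂P = ∫ ω in A, c ∂P := by
    refine setIntegral_congr_ae hAm ?_
    filter_upwards [hU.transition n l] with ω hω hωA
    rw [← hc ω hωA]; exact hω
  rw [h2, setIntegral_const, setIntegral_indicator hBm, setIntegral_const, smul_eq_mul,
    smul_eq_mul, mul_one] at h1
  have h3 : P (A ∩ B) = ENNReal.ofReal (P.real (A ∩ B)) := (ofReal_measureReal).symm
  rw [h3, ← h1, ENNReal.ofReal_mul measureReal_nonneg, ofReal_measureReal]

/-- The probabilities that the rule gives to the two letters add up to one, so that almost surely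
`U (n + 1)` is `U n` followed by a letter. -/
lemma IsVLMC.ae_eq_snoc (hU : IsVLMC α P U) (n : ℕ) :
    ∀ᵐ ω ∂P, U (n + 1) ω = snoc (U n ω) (U (n + 1) ω 0) := by
  have hB : ∀ l, MeasurableSet {ω | U (n + 1) ω = snoc (U n ω) l} := fun l =>
    hU.past_le (n + 1) _ (measurableSet_past_snoc U n l)
  have hreal : ∀ l, P.real {ω | U (n + 1) ω = snoc (U n ω) l} = ∫ ω, nextProb α (U n ω) l ∂P := by
    intro l
    rw [← integral_congr_ae (hU.transition n l), integral_condExp (hU.past_le n),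
      integral_indicator (hB l), setIntegral_const, smul_eq_mul, mul_one]
  have hint : ∀ l, Integrable (fun ω => nextProb α (U n ω) l) P := fun l =>
    integrable_condExp.congr (hU.transition n l)
  have hsum : P.real {ω | U (n + 1) ω = snoc (U n ω) u} +
      P.real {ω | U (n + 1) ω = snoc (U n ω) d} = 1 := by
    rw [hreal, hreal, ← integral_add (hint u) (hint d)]
    have : ∀ ω, nextProb α (U n ω) u + nextProb α (U n ω) d = 1 := by
      intro ω
      have := nextProb_add α (U n ω)
      rcases h : U n ω 0 <;> simp only [h, Bool.not_false, Bool.not_true] at this <;> linarith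
    simp [this]
  have hdisj : Disjoint {ω | U (n + 1) ω = snoc (U n ω) u} {ω | U (n + 1) ω = snoc (U n ω) d} := by
    rw [Set.disjoint_left]
    intro ω h1 h2
    have := congrFun (h1.symm.trans h2) 0
    simp [snoc] at this
  rw [← measureReal_union hdisj (hB d)] at hsum
  have hfull : ∀ᵐ ω ∂P, ω ∈ {ω | U (n + 1) ω = snoc (U n ω) u} ∪
      {ω | U (n + 1) ω = snoc (U n ω) d} := by
    refine (mem_ae_iff_prob_eq_one ((hB u).union (hB d))).2 ?_
    rw [measureReal_def] at hsum
    exact (ENNReal.toReal_eq_one_iff _).1 hsum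
  filter_upwards [hfull] with ω hω
  rcases hω with h | h <;> (have h0 := congrFun h 0; simp only [snoc] at h0; rw [h0]; exact h)

/-- If, at time `n`, a run of letters `l` begins on the event `A` of the past, then its length is
`t` on a subevent of `A`, of probability `P A * P(τ = t)`, on which a run of the other letter begins
at time `n + t`. -/
lemma IsVLMC.exists_run (hU : IsVLMC α P U)
    (hα : ∀ l : Letter, ∀ n : ℕ∞, 1 ≤ n → α l n ∈ Set.Icc (0 : ℝ) 1)
    {n : ℕ} {l : Letter} {A : Set Ω} (hA : MeasurableSet[past U n] A)
    (hAl : ∀ ω ∈ A, U n ω 0 = l ∧ runLength (U n ω) = 1) {t : ℕ} (ht : 1 ≤ t) :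
    ∃ B ⊆ A, MeasurableSet[past U (n + t)] B ∧
      (∀ ω ∈ B, U (n + t) ω 0 = !l ∧ runLength (U (n + t) ω) = 1) ∧
      (∀ ω ∈ B, ∀ s < t, U (n + s) ω 0 = l) ∧
      P B = P A * ENNReal.ofReal (runProb α l t) := by
  -- on `B`, the run has length at least `t + 1`
  have stay : ∀ t : ℕ, ∃ B ⊆ A, MeasurableSet[past U (n + t)] B ∧
      (∀ ω ∈ B, U (n + t) ω 0 = l ∧ runLength (U (n + t) ω) = (t + 1 : ℕ)) ∧
      (∀ ω ∈ B, ∀ s ≤ t, U (n + s) ω 0 = l) ∧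
      P B = P A * ENNReal.ofReal (tail α l (t + 1)) := by
    intro t
    induction t with
    | zero =>
      refine ⟨A, subset_rfl, hA, by simpa using hAl, fun ω hω s hs => ?_, by simp⟩
      obtain rfl : s = 0 := by omega
      exact (hAl ω hω).1
    | succ t ih =>
      obtain ⟨B, hBA, hB, hBl, hBs, hPB⟩ := ih
      have hnew : ∀ ω ∈ B ∩ {ω | U (n + t + 1) ω = snoc (U (n + t) ω) l},
          U (n + (t + 1)) ω 0 = l ∧ runLength (U (n + (t + 1)) ω) = (t + 1 + 1 : ℕ) := by
        rintro ω ⟨hω, hs⟩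
        have hs : U (n + t + 1) ω = snoc (U (n + t) ω) l := hs
        obtain ⟨h1, h2⟩ := hBl ω hω
        rw [← add_assoc, hs]
        refine ⟨rfl, ?_⟩
        conv_lhs => rw [← h1]
        rw [runLength_snoc_self, h2]
        push_cast; rfl
      refine ⟨B ∩ {ω | U (n + t + 1) ω = snoc (U (n + t) ω) l},
        Set.inter_subset_left.trans hBA, ?_, hnew, ?_, ?_⟩
      · exact MeasurableSet.inter (past_mono U (by omega) _ hB)
          (measurableSet_past_snoc U (n + t) l)
      · intro ω hω s hs
        rcases Nat.lt_or_ge t s with h | h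
        · obtain rfl : s = t + 1 := by omega
          exact (hnew ω hω).1
        · exact hBs ω hω.1 s h
      · rw [hU.measure_inter_snoc hB l (c := 1 - α l (t + 1 : ℕ)), hPB, tail_add_two,
          ENNReal.ofReal_mul (tail_nonneg hα l _), mul_assoc]
        intro ω hω
        obtain ⟨h1, h2⟩ := hBl ω hω
        simp [nextProb, h1, h2]
  obtain ⟨t, rfl⟩ : ∃ k, t = k + 1 := ⟨t - 1, by omega⟩
  obtain ⟨B, hBA, hB, hBl, hBs, hPB⟩ := stay t
  refine ⟨B ∩ {ω | U (n + t + 1) ω = snoc (U (n + t) ω) (!l)},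
    Set.inter_subset_left.trans hBA, ?_, ?_, ?_, ?_⟩
  · exact MeasurableSet.inter (past_mono U (by omega) _ hB)
      (measurableSet_past_snoc U (n + t) _)
  · rintro ω ⟨hω, hs⟩
    have hs : U (n + t + 1) ω = snoc (U (n + t) ω) (!l) := hs
    rw [← add_assoc, hs]
    refine ⟨rfl, runLength_snoc_of_ne ?_⟩
    rw [(hBl ω hω).1]; simp
  · exact fun ω hω s hs => hBs ω hω.1 s (by omega)
  · rw [hU.measure_inter_snoc hB (!l) (c := α l (t + 1 : ℕ)), hPB, runProb_succ,
      ENNReal.ofReal_mul (tail_nonneg hα l _), mul_assoc]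
    intro ω hω
    obtain ⟨h1, h2⟩ := hBl ω hω
    simp [nextProb, h1, h2]

/-- The letters of the successive runs, numbered from the run of descents that begins at
time `1`. -/
abbrev runLetter (j : ℕ) : Letter := j.bodd

/-- The event that the first `k` runs have lengths `t 0, …, t (k - 1)` and that a run begins
afterwards, together with its probability. -/
lemma IsVLMC.exists_runs (hU : IsVLMC α P U)
    (hα : ∀ l : Letter, ∀ n : ℕ∞, 1 ≤ n → α l n ∈ Set.Icc (0 : ℝ) 1)
    (t : ℕ → ℕ) (ht : ∀ j, 1 ≤ t j) (k : ℕ) :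
    ∃ B ⊆ upDownAtZero U, MeasurableSet[past U (1 + ∑ i ∈ Finset.range k, t i)] B ∧
      (∀ ω ∈ B, U (1 + ∑ i ∈ Finset.range k, t i) ω 0 = runLetter k ∧
        runLength (U (1 + ∑ i ∈ Finset.range k, t i) ω) = 1) ∧
      (∀ ω ∈ B, ∀ j < k, ∀ s < t j,
        U (1 + ∑ i ∈ Finset.range j, t i + s) ω 0 = runLetter j) ∧
      P B = P (upDownAtZero U) *
        ∏ j ∈ Finset.range k, ENNReal.ofReal (runProb α (runLetter j) (t j)) := by
  induction k with
  | zero =>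
    have hm : ∀ {k l}, k ≤ 1 → MeasurableSet[past U 1] {ω | U k ω 0 = l} := fun {k l} hk =>
      ((measurable_pi_apply 0).comp (measurable_past U hk)) (measurableSet_singleton l)
    refine ⟨upDownAtZero U ∩ {ω | U 1 ω = snoc (U 0 ω) d}, Set.inter_subset_left, ?_, ?_, ?_, ?_⟩
    · exact ((hm zero_le_one).inter (hm le_rfl)).inter (measurableSet_past_snoc U 0 d)
    · rintro ω ⟨h1, h2⟩
      have h2 : U 1 ω = snoc (U 0 ω) d := h2
      have h3 : U 0 ω 0 = u := h1.1
      simp only [Finset.range_zero, Finset.sum_empty, add_zero]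
      rw [h2]
      exact ⟨rfl, runLength_snoc_of_ne (by rw [h3]; simp)⟩
    · intro ω _ j hj; omega
    · simp only [Finset.range_zero, Finset.prod_empty, mul_one]
      refine measure_congr ?_
      filter_upwards [hU.ae_eq_snoc 0] with ω hω
      refine propext ⟨fun h => h.1, fun h => ⟨h, ?_⟩⟩
      have h1 : U 1 ω 0 = d := h.2
      simp only [zero_add, h1] at hω
      exact hω
  | succ k ih =>
    obtain ⟨A, hAsub, hA, hAl, hAs, hPA⟩ := ih
    obtain ⟨B, hBA, hB, hBl, hBs, hPB⟩ := hU.exists_run hα hA hAl (ht k)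
    refine ⟨B, hBA.trans hAsub, ?_, ?_, ?_, ?_⟩
    · rwa [Finset.sum_range_succ, ← add_assoc]
    · rw [Finset.sum_range_succ, ← add_assoc, runLetter, Nat.bodd_succ]
      exact hBl
    · intro ω hω j hj s hs
      rcases Nat.lt_or_ge j k with h | h
      · exact hAs ω (hBA hω) j h s hs
      · obtain rfl : j = k := by omega
        exact hBs ω hω s hs
    · rw [hPB, hPA, Finset.prod_range_succ, mul_assoc]

end Chain

/-! ### The run lengths of the letter process -/

/-- The least `t ≥ 1` such that the letter at place `n + t` differs from the one at place `n`; it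
has the junk value `0` if there is none. -/
noncomputable def nextRun (x : ℕ → Letter) (n : ℕ) : ℕ := sInf {t | 1 ≤ t ∧ x (n + t) ≠ x n}

/-- The time at which the `j`-th run begins, when the runs are counted from time `1`. -/
noncomputable def runStart (x : ℕ → Letter) : ℕ → ℕ
  | 0 => 1
  | j + 1 => runStart x j + nextRun x (runStart x j)

/-- The length of the `j`-th run, when the runs are counted from time `1`. -/
noncomputable def runLen (x : ℕ → Letter) (j : ℕ) : ℕ := nextRun x (runStart x j)

lemma nextRun_eq {x : ℕ → Letter} {n t : ℕ} (ht : 1 ≤ t) (h : ∀ s < t, x (n + s) = x n)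
    (hne : x (n + t) ≠ x n) : nextRun x n = t := by
  refine le_antisymm (Nat.sInf_le ⟨ht, hne⟩) ?_
  refine le_csInf ⟨t, ht, hne⟩ fun s hs => ?_
  by_contra hlt
  exact hs.2 (h s (not_le.1 hlt))

lemma apply_add_nextRun {x : ℕ → Letter} {n : ℕ} (h : nextRun x n ≠ 0) :
    x (n + nextRun x n) = !x n := by
  have : nextRun x n ∈ {t | 1 ≤ t ∧ x (n + t) ≠ x n} :=
    Nat.sInf_mem (Nat.nonempty_of_pos_sInf (Nat.pos_of_ne_zero h))
  exact Bool.eq_not_of_ne this.2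

lemma apply_add_of_lt_nextRun {x : ℕ → Letter} {n s : ℕ} (h : s < nextRun x n) :
    x (n + s) = x n := by
  rcases s with _ | s
  · rfl
  · by_contra hne
    exact Nat.notMem_of_lt_sInf h ⟨Nat.succ_pos s, hne⟩

lemma runStart_eq (x : ℕ → Letter) (j : ℕ) :
    runStart x j = 1 + ∑ i ∈ Finset.range j, runLen x i := by
  induction j with
  | zero => rfl
  | succ j ih => rw [Finset.sum_range_succ, ← add_assoc, ← ih]; rfl

lemma measurable_nextRun (n : ℕ) : Measurable fun x : ℕ → Letter => nextRun x n := by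
  have hS : ∀ t : ℕ, MeasurableSet {x : ℕ → Letter | x t ≠ x n} := fun t =>
    (measurableSet_eq_fun (measurable_pi_apply t) (measurable_pi_apply n)).compl
  have key : ∀ t : ℕ, MeasurableSet {x : ℕ → Letter | 1 ≤ nextRun x n ∧ nextRun x n ≤ t} := by
    intro t
    have : {x : ℕ → Letter | 1 ≤ nextRun x n ∧ nextRun x n ≤ t} =
        ⋃ s ∈ Finset.Icc 1 t, {x | x (n + s) ≠ x n} := by
      ext x
      simp only [Set.mem_ofPred_eq, Set.mem_iUnion, Finset.mem_Icc, exists_prop]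
      constructor
      · rintro ⟨h1, h2⟩
        refine ⟨nextRun x n, ⟨h1, h2⟩, ?_⟩
        have h0 : nextRun x n ≠ 0 := by omega
        rw [apply_add_nextRun h0]
        simp
      · rintro ⟨s, ⟨h1, h2⟩, h3⟩
        have hle : nextRun x n ≤ s := Nat.sInf_le ⟨h1, h3⟩
        have hmem : nextRun x n ∈ {t | 1 ≤ t ∧ x (n + t) ≠ x n} := Nat.sInf_mem ⟨s, h1, h3⟩
        exact ⟨hmem.1, hle.trans h2⟩
    rw [this]
    exact Finset.measurableSet_biUnion _ fun s _ => hS _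
  have hpos : ∀ t : ℕ, 1 ≤ t → MeasurableSet {x : ℕ → Letter | nextRun x n = t} := by
    intro t ht
    have : {x : ℕ → Letter | nextRun x n = t} =
        {x | 1 ≤ nextRun x n ∧ nextRun x n ≤ t} \
          {x | 1 ≤ nextRun x n ∧ nextRun x n ≤ t - 1} := by
      ext x; simp only [Set.mem_ofPred_eq, Set.mem_sdiff]; omega
    rw [this]
    exact (key t).diff (key (t - 1))
  refine measurable_to_countable' fun t => ?_
  rcases Nat.eq_zero_or_pos t with rfl | ht
  · have : (fun x : ℕ → Letter => nextRun x n) ⁻¹' {0} =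
        (⋃ t : ℕ, {x | nextRun x n = t + 1})ᶜ := by
      ext x
      simp only [Set.mem_preimage, Set.mem_singleton_iff, Set.mem_compl_iff, Set.mem_iUnion,
        Set.mem_ofPred_eq, not_exists]
      exact ⟨fun h t => by omega, fun h => by_contra fun h0 => h (nextRun x n - 1) (by omega)⟩
    rw [this]
    exact (MeasurableSet.iUnion fun t => hpos _ (Nat.succ_pos t)).compl
  · exact hpos t ht

lemma measurable_runLen (j : ℕ) : Measurable fun x : ℕ → Letter => runLen x j := by
  have hnext : Measurable fun p : ℕ × (ℕ → Letter) => nextRun p.2 p.1 :=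
    measurable_from_prod_countable_right measurable_nextRun
  have hstart : ∀ j, Measurable fun x : ℕ → Letter => runStart x j := by
    intro j
    induction j with
    | zero => exact measurable_const
    | succ j ih => exact ih.add (hnext.comp (ih.prodMk measurable_id))
  exact hnext.comp ((hstart j).prodMk measurable_id)

lemma runLen_eq {x : ℕ → Letter} {t : ℕ → ℕ} {k : ℕ} (ht : ∀ j, 1 ≤ t j)
    (h : ∀ j < k, ∀ s < t j, x (1 + ∑ i ∈ Finset.range j, t i + s) = runLetter j)
    (hk : x (1 + ∑ i ∈ Finset.range k, t i) = runLetter k) : ∀ j < k, runLen x j = t j := by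
  have h0 : ∀ j ≤ k, x (1 + ∑ i ∈ Finset.range j, t i) = runLetter j := by
    intro j hj
    rcases hj.lt_or_eq with hj | rfl
    · simpa using h j hj 0 (ht j)
    · exact hk
  intro j
  induction j using Nat.strong_induction_on with
  | _ j ih =>
    intro hj
    have hs : runStart x j = 1 + ∑ i ∈ Finset.range j, t i := by
      rw [runStart_eq]
      congr 1
      refine Finset.sum_congr rfl fun i hi => ?_
      have := Finset.mem_range.1 hi
      exact ih i this (this.trans hj)
    rw [runLen, hs]
    refine nextRun_eq (ht j) (fun s hs => ?_) ?_
    · rw [h j hj s hs, h0 j hj.le]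
    · rw [h0 j hj.le]
      have := h0 (j + 1) hj
      rw [Finset.sum_range_succ, ← add_assoc] at this
      rw [this, runLetter, Nat.bodd_succ]
      simp

/-- A probability measure on a countable space is determined by lower bounds for its atoms which
add up to one. -/
lemma measure_eq_of_singleton_le {X : Type*} [MeasurableSpace X] [MeasurableSingletonClass X]
    [Countable X] {μ ν : Measure X} [IsProbabilityMeasure μ] [IsProbabilityMeasure ν]
    (h : ∀ x, μ {x} ≤ ν {x}) : μ = ν := by
  refine Measure.eq_of_le_of_isProbabilityMeasure (Measure.le_intro fun s hs _ => ?_)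
  rw [← μ.tsum_indicator_apply_singleton s hs, ← ν.tsum_indicator_apply_singleton s hs]
  exact ENNReal.tsum_le_tsum fun x => Set.indicator_le_indicator (h x)

section RunLaw

variable {Ω : Type*} [MeasurableSpace Ω] {α : Letter → ℕ∞ → ℝ} {P : Measure Ω}
  {U : ℕ → Ω → LeftWord}

lemma IsVLMC.measurable_letter (hU : IsVLMC α P U) :
    Measurable fun ω n => letter U n ω :=
  measurable_pi_lambda _ fun n => (measurable_pi_apply 0).comp (hU.measurable n)

lemma IsVLMC.measurableSet_upDownAtZero (hU : IsVLMC α P U) :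
    MeasurableSet (upDownAtZero U) :=
  (((measurable_pi_apply 0).comp (hU.measurable 0)) (measurableSet_singleton u)).inter
    (((measurable_pi_apply 0).comp (hU.measurable 1)) (measurableSet_singleton d))

/-- Given that an up-down breaking time occurs at time `0`, the joint law of the lengths of the
successive runs is a product law: each value of the first `k + 1` lengths has at least the
probability that the product law gives it by `IsVLMC.exists_runs`, and these add up to one. -/
lemma IsVLMC.map_runLen [IsProbabilityMeasure P] (hU : IsVLMC α P U)
    (hα : ∀ l : Letter, ∀ n : ℕ∞, 1 ≤ n → α l n ∈ Set.Icc (0 : ℝ) 1)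
    (hadm : Admissible α) (hpos : P (upDownAtZero U) ≠ 0) :
    (cond P (upDownAtZero U)).map (fun ω j => runLen (fun n => letter U n ω) j) =
      haveI := isProbabilityMeasure_runLaw hα hadm
      Measure.infinitePi fun j => runLaw α (runLetter j) := by
  have := isProbabilityMeasure_runLaw hα hadm
  have hQ : IsProbabilityMeasure (cond P (upDownAtZero U)) := cond_isProbabilityMeasure hpos
  have hT : Measurable fun ω j => runLen (fun n => letter U n ω) j :=
    measurable_pi_lambda _ fun j => (measurable_runLen j).comp hU.measurable_letter
  have := Measure.isProbabilityMeasure_map (μ := cond P (upDownAtZero U)) hT.aemeasurable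
  refine IsProjectiveLimit.unique ?_ (Measure.isProjectiveLimit_infinitePi _)
  refine (isProjectiveLimit_nat_iff
    (isProjectiveMeasureFamily_pi fun j => runLaw α (runLetter j)) _).2 fun k => ?_
  have hrm : Measurable (Preorder.frestrictLe (π := fun _ : ℕ => ℕ) k) :=
    Preorder.measurable_frestrictLe k
  have := Measure.isProbabilityMeasure_map
    (μ := (cond P (upDownAtZero U)).map fun ω j => runLen (fun n => letter U n ω) j)
    hrm.aemeasurable
  refine (measure_eq_of_singleton_le fun y => ?_).symm
  rw [Measure.pi_singleton]
  -- run lengths `0` are junk, and have probability `0` under `runLaw`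
  by_cases hy : ∃ j, y j = 0
  · obtain ⟨j, hj⟩ := hy
    rw [Finset.prod_eq_zero (Finset.mem_univ j)]
    · exact zero_le
    · rw [hj, runLaw_singleton, runProb_zero, ENNReal.ofReal_zero]
  push Not at hy
  set t : ℕ → ℕ := fun j => if h : j ∈ Finset.Iic k then y ⟨j, h⟩ else 1 with ht
  have ht1 : ∀ j, 1 ≤ t j := by
    intro j
    simp only [ht]
    split_ifs with h
    · exact Nat.one_le_iff_ne_zero.2 (hy ⟨j, h⟩)
    · exact le_rfl
  obtain ⟨B, hBsub, hB, hBl, hBs, hPB⟩ := hU.exists_runs hα t ht1 (k + 1)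
  have hle : B ⊆ (fun ω j => runLen (fun n => letter U n ω) j) ⁻¹'
      (Preorder.frestrictLe (π := fun _ : ℕ => ℕ) k ⁻¹' {y}) := by
    intro ω hω
    have := runLen_eq (x := fun n => letter U n ω) ht1 (hBs ω hω) (hBl ω hω).1
    simp only [Set.mem_preimage, Set.mem_singleton_iff]
    funext j
    have hj := j.2
    have hj' := Finset.mem_Iic.1 hj
    have h1 := this j (by omega)
    simp only [ht, hj, dif_pos] at h1
    exact h1
  rw [Measure.map_apply hrm (measurableSet_singleton y),
    Measure.map_apply hT (hrm (measurableSet_singleton y))]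
  refine le_trans ?_ (measure_mono hle)
  rw [cond_apply hU.measurableSet_upDownAtZero, Set.inter_eq_right.2 hBsub, hPB, ← mul_assoc,
    ENNReal.inv_mul_cancel hpos (measure_ne_top _ _), one_mul]
  have hIic : Finset.range (k + 1) = Finset.Iic k := by ext; simp
  rw [hIic, ← Finset.prod_coe_sort (Finset.Iic k)
    fun j => ENNReal.ofReal (runProb α (runLetter j) (t j))]
  refine (Finset.prod_congr rfl fun j _ => ?_).le
  rw [runLaw_singleton]
  simp [ht, Finset.mem_Iic.1 j.2]

end RunLaw

/-! ### Counting the letters of a sequence -/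

/-- The number of letters `l` at the times `1, …, n`. -/
def letterCount (x : ℕ → Letter) (l : Letter) (n : ℕ) : ℕ :=
  ∑ k ∈ Finset.range n, if x (k + 1) = l then 1 else 0

lemma letterCount_succ (x : ℕ → Letter) (l : Letter) (n : ℕ) :
    letterCount x l (n + 1) = letterCount x l n + if x (n + 1) = l then 1 else 0 :=
  Finset.sum_range_succ _ _

lemma monotone_letterCount (x : ℕ → Letter) (l : Letter) : Monotone (letterCount x l) :=
  monotone_nat_of_le_succ fun n => by rw [letterCount_succ]; exact Nat.le_add_right _ _

lemma letterCount_add (x : ℕ → Letter) (n : ℕ) : letterCount x u n + letterCount x d n = n := by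
  induction n with
  | zero => simp [letterCount]
  | succ n ih =>
    rw [letterCount_succ, letterCount_succ]
    rcases x (n + 1) <;> simp <;> omega

lemma sum_jump (x : ℕ → Letter) (n : ℕ) :
    ∑ k ∈ Finset.Icc 1 n, jump (x k) = (letterCount x u n : ℤ) - letterCount x d n := by
  induction n with
  | zero => simp [letterCount]
  | succ n ih =>
    rw [Finset.sum_Icc_succ_top (by omega), ih]
    rw [letterCount_succ, letterCount_succ]
    rcases x (n + 1) <;> simp [jump] <;> ring

/-- The time at which the first `j` pairs of a run of descents and a run of rises end. -/
noncomputable def pairEnd (x : ℕ → Letter) (j : ℕ) : ℕ :=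
  ∑ i ∈ Finset.range j, (runLen x (2 * i) + runLen x (2 * i + 1))

section Runs

variable {x : ℕ → Letter} (hx : x 1 = d) (hpos : ∀ j, runLen x j ≠ 0)

include hx hpos

lemma apply_runStart (j : ℕ) : x (runStart x j) = runLetter j := by
  induction j with
  | zero => exact hx
  | succ j ih =>
    rw [runStart, apply_add_nextRun (hpos j), ih, runLetter, runLetter, Nat.bodd_succ]

lemma letterCount_runs (l : Letter) (m : ℕ) :
    letterCount x l (∑ i ∈ Finset.range m, runLen x i) =
      ∑ i ∈ Finset.range m, if runLetter i = l then runLen x i else 0 := by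
  induction m with
  | zero => simp [letterCount]
  | succ m ih =>
    rw [Finset.sum_range_succ, Finset.sum_range_succ, ← ih, letterCount, Finset.sum_range_add]
    congr 1
    have : ∀ s ∈ Finset.range (runLen x m),
        (if x (∑ i ∈ Finset.range m, runLen x i + s + 1) = l then 1 else 0) =
          if runLetter m = l then 1 else 0 := by
      intro s hs
      have h1 : x (runStart x m + s) = x (runStart x m) :=
        apply_add_of_lt_nextRun (Finset.mem_range.1 hs)
      rw [apply_runStart hx hpos, runStart_eq] at h1
      rw [show ∑ i ∈ Finset.range m, runLen x i + s + 1 =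
        1 + ∑ i ∈ Finset.range m, runLen x i + s by ring, h1]
    rw [Finset.sum_congr rfl this]
    split_ifs <;> simp

omit hx hpos in
lemma sum_range_two_mul (f : ℕ → ℕ) (j : ℕ) :
    ∑ i ∈ Finset.range (2 * j), f i = ∑ i ∈ Finset.range j, (f (2 * i) + f (2 * i + 1)) := by
  induction j with
  | zero => simp
  | succ j ih =>
    rw [mul_add, mul_one, Finset.sum_range_succ, Finset.sum_range_succ, ih,
      Finset.sum_range_succ, add_assoc]

lemma letterCount_d_pairEnd (j : ℕ) :
    letterCount x d (pairEnd x j) = ∑ i ∈ Finset.range j, runLen x (2 * i) := by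
  rw [pairEnd, ← sum_range_two_mul, letterCount_runs hx hpos, sum_range_two_mul]
  simp

lemma letterCount_u_pairEnd (j : ℕ) :
    letterCount x u (pairEnd x j) = ∑ i ∈ Finset.range j, runLen x (2 * i + 1) := by
  rw [pairEnd, ← sum_range_two_mul, letterCount_runs hx hpos, sum_range_two_mul]
  simp

omit hx in
lemma strictMono_pairEnd : StrictMono (pairEnd x) :=
  strictMono_nat_of_lt_succ fun j => by
    rw [pairEnd, pairEnd, Finset.sum_range_succ]
    have := hpos (2 * j)
    omega

end Runs

/-- Inversion of a law of large numbers: the growth rate of a monotone sequence is determined by its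
values along a sequence `B` of integers with a growth rate. -/
lemma tendsto_div_of_subseq {c B : ℕ → ℕ} (hc : Monotone c) (hB : StrictMono B) (hB0 : B 0 = 0)
    {a r : ℝ} (ha : Tendsto (fun j : ℕ => (c (B j) : ℝ) / j) atTop (𝓝 a))
    (hr : Tendsto (fun j : ℕ => (j : ℝ) / B j) atTop (𝓝 r)) :
    Tendsto (fun n => (c n : ℝ) / n) atTop (𝓝 (a * r)) := by
  have hex : ∀ n, ∃ j, B j ≤ n ∧ n < B (j + 1) := by
    intro n
    have h : ∃ j, n < B (j + 1) := ⟨n, hB.le_apply⟩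
    classical
    refine ⟨Nat.find h, ?_, Nat.find_spec h⟩
    rcases hj : Nat.find h with _ | j
    · omega
    · exact not_lt.1 (Nat.find_min h (by omega : j < Nat.find h))
  choose k hk1 hk2 using hex
  have hk : Tendsto k atTop atTop := by
    refine tendsto_atTop.2 fun m => eventually_atTop.2 ⟨B m, fun n hn => ?_⟩
    have := hB.lt_iff_lt.1 (hn.trans_lt (hk2 n))
    omega
  have hone : Tendsto (fun j : ℕ => ((j + 1 : ℕ) : ℝ) / j) atTop (𝓝 1) := by
    have := tendsto_natCast_div_add_atTop (1 : ℝ)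
    have h2 := this.inv₀ one_ne_zero
    simpa [inv_div] using h2
  have hone' : Tendsto (fun j : ℕ => (j : ℝ) / (j + 1 : ℕ)) atTop (𝓝 1) := by
    simpa using tendsto_natCast_div_add_atTop (1 : ℝ)
  -- `c (B j) / B (j + 1) ≤ c n / n ≤ c (B (j + 1)) / B j` for `B j ≤ n < B (j + 1)`
  have hup : Tendsto (fun j => (c (B (j + 1)) : ℝ) / B j) atTop (𝓝 (a * r)) := by
    have := ((ha.comp (tendsto_add_atTop_nat 1)).mul hone).mul hr
    rw [mul_one] at this
    refine this.congr' ?_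
    filter_upwards [eventually_gt_atTop 0] with j hj
    have : (j : ℝ) ≠ 0 := by positivity
    have : ((j + 1 : ℕ) : ℝ) ≠ 0 := by positivity
    simp only [Function.comp]
    rw [div_mul_div_cancel₀ (by assumption), div_mul_div_cancel₀ (by assumption)]
  have hlow : Tendsto (fun j => (c (B j) : ℝ) / B (j + 1)) atTop (𝓝 (a * r)) := by
    have := (ha.mul hone').mul (hr.comp (tendsto_add_atTop_nat 1))
    rw [mul_one] at this
    refine this.congr' ?_
    filter_upwards [eventually_gt_atTop 0] with j hj
    have : (j : ℝ) ≠ 0 := by positivity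
    have : ((j + 1 : ℕ) : ℝ) ≠ 0 := by positivity
    simp only [Function.comp]
    rw [div_mul_div_cancel₀ (by assumption), div_mul_div_cancel₀ (by assumption)]
  refine tendsto_of_tendsto_of_tendsto_of_le_of_le' (hlow.comp hk) (hup.comp hk) ?_ ?_
  · filter_upwards [eventually_gt_atTop 0] with n hn
    have h1 : (c (B (k n)) : ℝ) ≤ c n := by exact_mod_cast hc (hk1 n)
    have h2 : (n : ℝ) ≤ B (k n + 1) := by exact_mod_cast (hk2 n).le
    have h3 : (0 : ℝ) < n := by exact_mod_cast hn
    exact div_le_div₀ (Nat.cast_nonneg _) h1 h3 h2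
  · filter_upwards [hk.eventually_gt_atTop 0] with n hn
    have h1 : (c n : ℝ) ≤ c (B (k n + 1)) := by exact_mod_cast hc (hk2 n).le
    have h2 : (B (k n) : ℝ) ≤ n := by exact_mod_cast hk1 n
    have h3 : (0 : ℝ) < B (k n) := by exact_mod_cast hB0 ▸ hB hn
    exact div_le_div₀ (Nat.cast_nonneg _) h1 h3 h2

/-! ### Laws of large numbers for integer variables -/

section StrongLaw

variable {Ω : Type*} [MeasurableSpace Ω] {Q : Measure Ω} {X : ℕ → Ω → ℕ}

lemma integrable_natCast (hX : Measurable (X 0)) (hfin : ∫⁻ ω, (X 0 ω : ℝ≥0∞) ∂Q ≠ ∞) :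
    Integrable (fun ω => (X 0 ω : ℝ)) Q := by
  refine ⟨(measurable_from_top.comp hX).aestronglyMeasurable, ?_⟩
  rw [hasFiniteIntegral_iff_ofReal (ae_of_all _ fun ω => Nat.cast_nonneg _)]
  simpa using hfin.lt_top

lemma integral_natCast (hX : Measurable (X 0)) :
    ∫ ω, (X 0 ω : ℝ) ∂Q = (∫⁻ ω, (X 0 ω : ℝ≥0∞) ∂Q).toReal := by
  rw [integral_eq_lintegral_of_nonneg_ae (ae_of_all _ fun ω => Nat.cast_nonneg _)
    (measurable_from_top.comp hX).aestronglyMeasurable]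
  simp

lemma strong_law_natCast (hX : ∀ j, Measurable (X j))
    (hind : Pairwise fun i j => IndepFun (X i) (X j) Q)
    (hid : ∀ j, IdentDistrib (X j) (X 0) Q Q) (hfin : ∫⁻ ω, (X 0 ω : ℝ≥0∞) ∂Q ≠ ∞) :
    ∀ᵐ ω ∂Q, Tendsto (fun n : ℕ => ((∑ i ∈ Finset.range n, X i ω : ℕ) : ℝ) / n) atTop
      (𝓝 (∫⁻ ω, (X 0 ω : ℝ≥0∞) ∂Q).toReal) := by
  have hcast : Measurable (Nat.cast : ℕ → ℝ) := measurable_from_top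
  have := strong_law_ae_real (μ := Q) (fun j ω => (X j ω : ℝ)) (integrable_natCast (hX 0) hfin)
    (fun i j hij => (hind hij).comp hcast hcast) (fun j => (hid j).comp hcast)
  rw [integral_natCast (hX 0)] at this
  simpa using this

/-- The strong law for nonnegative variables of infinite mean, by truncation. -/
lemma strong_law_natCast_top [IsProbabilityMeasure Q] (hX : ∀ j, Measurable (X j))
    (hind : Pairwise fun i j => IndepFun (X i) (X j) Q)
    (hid : ∀ j, IdentDistrib (X j) (X 0) Q Q) (hfin : ∫⁻ ω, (X 0 ω : ℝ≥0∞) ∂Q = ∞) :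
    ∀ᵐ ω ∂Q, Tendsto (fun n : ℕ => ((∑ i ∈ Finset.range n, X i ω : ℕ) : ℝ) / n) atTop atTop := by
  have htrunc : ∀ K : ℕ, Measurable fun n : ℕ => min n K := fun K => measurable_from_top
  have hlt : ∀ K : ℕ, ∫⁻ ω, ((min (X 0 ω) K : ℕ) : ℝ≥0∞) ∂Q ≠ ∞ := by
    intro K
    refine ne_top_of_le_ne_top (ENNReal.natCast_ne_top K) ?_
    calc ∫⁻ ω, ((min (X 0 ω) K : ℕ) : ℝ≥0∞) ∂Q ≤ ∫⁻ ω, (K : ℝ≥0∞) ∂Q :=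
          lintegral_mono fun ω => Nat.cast_le.2 (min_le_right (X 0 ω) K)
      _ = K := by simp
  have hlaw : ∀ᵐ ω ∂Q, ∀ K : ℕ, Tendsto
      (fun n : ℕ => ((∑ i ∈ Finset.range n, min (X i ω) K : ℕ) : ℝ) / n) atTop
      (𝓝 (∫⁻ ω, ((min (X 0 ω) K : ℕ) : ℝ≥0∞) ∂Q).toReal) :=
    ae_all_iff.2 fun K => strong_law_natCast (X := fun j ω => min (X j ω) K)
      (fun j => (htrunc K).comp (hX j)) (fun i j hij => (hind hij).comp (htrunc K) (htrunc K))
      (fun j => (hid j).comp (htrunc K)) (hlt K)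
  have hmono : Tendsto (fun K : ℕ => ∫⁻ ω, ((min (X 0 ω) K : ℕ) : ℝ≥0∞) ∂Q) atTop (𝓝 ∞) := by
    rw [← hfin]
    refine lintegral_tendsto_of_tendsto_of_monotone
      (fun K => ?_) ?_ ?_
    · have hcast : Measurable fun n : ℕ => ((min n K : ℕ) : ℝ≥0∞) := measurable_from_top
      exact (hcast.comp (hX 0)).aemeasurable
    · refine ae_of_all _ fun ω K L hKL => ?_
      exact Nat.cast_le.2 (min_le_min_left _ hKL)
    · refine ae_of_all _ fun ω => tendsto_const_nhds.congr' ?_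
      filter_upwards [eventually_ge_atTop (X 0 ω)] with K hK
      rw [min_eq_left hK]
  filter_upwards [hlaw] with ω hω
  refine tendsto_atTop.2 fun C => ?_
  obtain ⟨K, hK⟩ := (hmono.eventually (lt_mem_nhds (ENNReal.ofReal_lt_top (r := |C|)))).exists
  have hC : C < (∫⁻ ω, ((min (X 0 ω) K : ℕ) : ℝ≥0∞) ∂Q).toReal :=
    (le_abs_self C).trans_lt ((ENNReal.ofReal_lt_iff_lt_toReal (abs_nonneg C) (hlt K)).1 hK)
  filter_upwards [(hω K).eventually (lt_mem_nhds hC)] with n hn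
  refine hn.le.trans ?_
  gcongr
  exact min_le_left _ _

end StrongLaw

/-! ### Centred random walks are unbounded -/

/-- The supremum, in `[0, ∞]`, of the partial sums of a sequence of real numbers. -/
noncomputable def supSum (z : ℕ → ℝ) : ℝ≥0∞ :=
  ⨆ n : ℕ, ENNReal.ofReal (∑ i ∈ Finset.range n, z i)

lemma measurable_supSum : Measurable supSum :=
  Measurable.iSup fun _ =>
    (Finset.measurable_fun_sum _ fun i _ => measurable_pi_apply i).ennreal_ofReal

lemma sum_le_toReal_supSum {z : ℕ → ℝ} (hz : supSum z ≠ ∞) (n : ℕ) :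
    ∑ i ∈ Finset.range n, z i ≤ (supSum z).toReal :=
  (ENNReal.ofReal_le_iff_le_toReal hz).1 (le_iSup (fun n : ℕ =>
    ENNReal.ofReal (∑ i ∈ Finset.range n, z i)) n)

lemma supSum_succ_le (z : ℕ → ℝ) :
    supSum (fun i => z (i + 1)) ≤ supSum z + ENNReal.ofReal |z 0| := by
  refine iSup_le fun n => ?_
  have h : ∑ i ∈ Finset.range n, z (i + 1) ≤ ∑ i ∈ Finset.range (n + 1), z i + |z 0| := by
    rw [Finset.sum_range_succ']
    linarith [neg_abs_le (z 0)]
  refine (ENNReal.ofReal_le_ofReal h).trans (ENNReal.ofReal_add_le.trans ?_)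
  gcongr
  exact le_iSup (fun n : ℕ => ENNReal.ofReal (∑ i ∈ Finset.range n, z i)) (n + 1)

lemma supSum_le_succ (z : ℕ → ℝ) :
    supSum z ≤ supSum (fun i => z (i + 1)) + ENNReal.ofReal |z 0| := by
  refine iSup_le fun n => ?_
  rcases n with _ | n
  · simp
  · rw [Finset.sum_range_succ']
    refine ENNReal.ofReal_add_le.trans ?_
    gcongr
    · exact le_iSup (fun n : ℕ => ENNReal.ofReal (∑ i ∈ Finset.range n, z (i + 1))) n
    · exact le_abs_self _

lemma add_toReal_supSum_le {z : ℕ → ℝ} (hz : supSum z ≠ ∞) :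
    z 0 + (supSum fun i => z (i + 1)).toReal ≤ (supSum z).toReal := by
  have h0 : z 0 ≤ (supSum z).toReal := by simpa using sum_le_toReal_supSum hz 1
  have h : supSum (fun i => z (i + 1)) ≤ ENNReal.ofReal ((supSum z).toReal - z 0) := by
    refine iSup_le fun n => ENNReal.ofReal_le_ofReal ?_
    have := sum_le_toReal_supSum hz (n + 1)
    rw [Finset.sum_range_succ'] at this
    linarith
  have := ENNReal.toReal_le_of_le_ofReal (by linarith) h
  linarith

section Walk

variable {Ω : Type*} [MeasurableSpace Ω] {Q : Measure Ω} [IsProbabilityMeasure Q]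
  {Y : ℕ → Ω → ℝ}

/-- For a centred random walk, the supremum of the partial sums and the one of the walk started
after its first step `Y 0` almost surely differ by exactly `Y 0`, where the latter is finite: they
have the same law, so that their difference has mean zero, and this difference is at least `Y 0`. -/
lemma ae_toReal_supSum_eq (hY : ∀ i, Measurable (Y i))
    (hlaw : IdentDistrib (fun ω i => Y i ω) (fun ω i => Y (i + 1) ω) Q Q)
    (hind : IndepFun (Y 0) (fun ω i => Y (i + 1) ω) Q)
    (hint : Integrable (Y 0) Q) (hmean : ∫ ω, Y 0 ω ∂Q = 0) :
    ∀ᵐ ω ∂Q, supSum (fun i => Y (i + 1) ω) ≠ ∞ → supSum (fun i => Y i ω) ≠ ∞ ∧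
      (supSum fun i => Y i ω).toReal = Y 0 ω + (supSum fun i => Y (i + 1) ω).toReal := by
  set W : Ω → ℝ≥0∞ := fun ω => supSum fun i => Y i ω with hW
  set W' : Ω → ℝ≥0∞ := fun ω => supSum fun i => Y (i + 1) ω with hW'
  have hWm : Measurable W := measurable_supSum.comp (measurable_pi_lambda _ hY)
  have hW'm : Measurable W' := measurable_supSum.comp (measurable_pi_lambda _ fun i => hY (i + 1))
  have hWlaw : IdentDistrib W W' Q Q := hlaw.comp measurable_supSum
  have hWW' : ∀ ω, W' ω ≠ ∞ → W ω ≠ ∞ := fun ω h =>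
    ne_top_of_le_ne_top (ENNReal.add_ne_top.2 ⟨h, ENNReal.ofReal_ne_top⟩)
      (supSum_le_succ fun i => Y i ω)
  have hW'W : ∀ ω, W ω ≠ ∞ → W' ω ≠ ∞ := fun ω h =>
    ne_top_of_le_ne_top (ENNReal.add_ne_top.2 ⟨h, ENNReal.ofReal_ne_top⟩)
      (supSum_succ_le fun i => Y i ω)
  -- the truncations `min W c` are integrable, so that their difference has mean zero
  set f : ℕ → ℝ≥0∞ → ℝ := fun c w => (min w c).toReal with hf
  have hfm : ∀ c, Measurable (f c) := fun c =>
    (measurable_id.min measurable_const).ennreal_toReal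
  have hf0 : ∀ c w, 0 ≤ f c w := fun c w => ENNReal.toReal_nonneg
  have hfc : ∀ c w, f c w ≤ c := fun c w => by
    have := ENNReal.toReal_mono (ENNReal.natCast_ne_top c) (min_le_right w (c : ℝ≥0∞))
    simpa using this
  have hfint : ∀ c (V : Ω → ℝ≥0∞), Measurable V → Integrable (fun ω => f c (V ω)) Q := by
    intro c V hV
    refine Integrable.of_bound ((hfm c).comp hV).aestronglyMeasurable c (ae_of_all _ fun ω => ?_)
    rw [Real.norm_of_nonneg (hf0 c _)]
    exact hfc c _
  have hflow : ∀ c ω, 0 ≤ f c (W ω) - f c (W' ω) + |Y 0 ω| := by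
    intro c ω
    have h1 : min (W' ω) (c : ℝ≥0∞) ≤ min (W ω) c + ENNReal.ofReal |Y 0 ω| := by
      rw [min_add]
      exact min_le_min (supSum_succ_le fun i => Y i ω) le_self_add
    have h2 := ENNReal.toReal_mono (ENNReal.add_ne_top.2
      ⟨ne_top_of_le_ne_top (ENNReal.natCast_ne_top c) (min_le_right _ _), ENNReal.ofReal_ne_top⟩) h1
    rw [ENNReal.toReal_add (ne_top_of_le_ne_top (ENNReal.natCast_ne_top c) (min_le_right _ _))
      ENNReal.ofReal_ne_top, ENNReal.toReal_ofReal (abs_nonneg _)] at h2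
    simp only [hf]
    linarith
  set g : Ω → ℝ := fun ω => if W' ω = ∞ then 0 else (W ω).toReal - (W' ω).toReal with hg
  have hflim : ∀ w : ℝ≥0∞, w ≠ ∞ → Tendsto (fun c => f c w) atTop (𝓝 w.toReal) := by
    intro w hw
    refine tendsto_const_nhds.congr' ?_
    obtain ⟨K, hK⟩ := ENNReal.exists_nat_gt hw
    filter_upwards [eventually_ge_atTop K] with c hc
    simp only [hf]
    rw [min_eq_left (hK.le.trans (by exact_mod_cast hc))]
  have hglim : ∀ ω, Tendsto (fun c => f c (W ω) - f c (W' ω)) atTop (𝓝 (g ω)) := by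
    intro ω
    by_cases h : W' ω = ∞
    · have h' : W ω = ∞ := by_contra fun h' => hW'W ω h' h
      simp [hg, h, h']
    · simp only [hg, h, if_false]
      exact (hflim _ (hWW' ω h)).sub (hflim _ h)
  have hgm : Measurable g := measurable_of_tendsto_metrizable
    (fun c => ((hfm c).comp hWm).sub ((hfm c).comp hW'm)) (tendsto_pi_nhds.2 hglim)
  have hfatou : ∫⁻ ω, ENNReal.ofReal (g ω + |Y 0 ω|) ∂Q ≤ ENNReal.ofReal (∫ ω, |Y 0 ω| ∂Q) := by
    have hlim : ∀ ω, liminf (fun c => ENNReal.ofReal (f c (W ω) - f c (W' ω) + |Y 0 ω|)) atTop =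
        ENNReal.ofReal (g ω + |Y 0 ω|) := fun ω =>
      (ENNReal.tendsto_ofReal ((hglim ω).add_const _)).liminf_eq
    simp_rw [← hlim]
    refine (lintegral_liminf_le fun c => ((((hfm c).comp hWm).sub ((hfm c).comp hW'm)).add
      (hY 0).abs).ennreal_ofReal).trans ?_
    have : ∀ c, ∫⁻ ω, ENNReal.ofReal (f c (W ω) - f c (W' ω) + |Y 0 ω|) ∂Q =
        ENNReal.ofReal (∫ ω, |Y 0 ω| ∂Q) := by
      intro c
      have hi := (hfint c W hWm).sub (hfint c W' hW'm)
      rw [← ofReal_integral_eq_lintegral_ofReal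
        (f := fun ω => f c (W ω) - f c (W' ω) + |Y 0 ω|) (hi.add hint.abs) (ae_of_all _ (hflow c))]
      congr 1
      have h1 := integral_add hi hint.abs
      have h2 := integral_sub (hfint c W hWm) (hfint c W' hW'm)
      have h3 : ∫ ω, f c (W ω) ∂Q = ∫ ω, f c (W' ω) ∂Q := (hWlaw.comp (hfm c)).integral_eq
      simp only [Pi.sub_apply] at h1
      rw [h1, h2, h3, sub_self, zero_add]
    simp [this]
  -- the same integral for the lower bound `Y 0` of the difference
  set φ : ℝ≥0∞ → ℝ := fun w => if w = ∞ then 0 else 1 with hφ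
  have hφm : Measurable φ := Measurable.ite (measurableSet_singleton ∞) measurable_const
    measurable_const
  have hmul : ∫ ω, Y 0 ω * φ (W' ω) ∂Q = 0 := by
    have hI : IndepFun (Y 0) (fun ω => φ (W' ω)) Q :=
      hind.comp measurable_id (hφm.comp measurable_supSum)
    rw [hI.integral_fun_mul_eq_mul_integral hint.aestronglyMeasurable
      (hφm.comp hW'm).aestronglyMeasurable, hmean, zero_mul]
  have hφle : ∀ w, ‖φ w‖ ≤ 1 := fun w => by simp only [hφ]; split_ifs <;> simp
  have hmulint : Integrable (fun ω => Y 0 ω * φ (W' ω)) Q :=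
    hint.mul_bdd (c := 1) (hφm.comp hW'm).aestronglyMeasurable (ae_of_all _ fun ω => hφle _)
  have hlow0 : ∀ ω, 0 ≤ Y 0 ω * φ (W' ω) + |Y 0 ω| := by
    intro ω
    simp only [hφ]
    split_ifs
    · simp
    · linarith [neg_abs_le (Y 0 ω)]
  have hlowint : ∫⁻ ω, ENNReal.ofReal (Y 0 ω * φ (W' ω) + |Y 0 ω|) ∂Q =
      ENNReal.ofReal (∫ ω, |Y 0 ω| ∂Q) := by
    rw [← ofReal_integral_eq_lintegral_ofReal (f := fun ω => Y 0 ω * φ (W' ω) + |Y 0 ω|)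
      (hmulint.add hint.abs) (ae_of_all _ hlow0),
      integral_add hmulint hint.abs, hmul, zero_add]
  have hle : ∀ ω, Y 0 ω * φ (W' ω) + |Y 0 ω| ≤ g ω + |Y 0 ω| := by
    intro ω
    simp only [hφ, hg]
    split_ifs with h
    · simp
    · have := add_toReal_supSum_le (z := fun i => Y i ω) (hWW' ω h)
      simp only [hW, hW']
      linarith
  have hae := ae_eq_of_ae_le_of_lintegral_le
    (ae_of_all Q fun ω => ENNReal.ofReal_le_ofReal (hle ω))
    (by rw [hlowint]; exact ENNReal.ofReal_ne_top)
    (hgm.add (hY 0).abs).ennreal_ofReal.aemeasurable (hlowint ▸ hfatou)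
  filter_upwards [hae] with ω hω h
  refine ⟨hWW' ω h, ?_⟩
  have h1 := (ENNReal.ofReal_eq_ofReal_iff (hlow0 ω) ((hlow0 ω).trans (hle ω))).1 hω
  have h' : W' ω ≠ ∞ := h
  simp only [hφ, hg, h', if_false] at h1
  change (W ω).toReal = Y 0 ω + (W' ω).toReal
  linarith

/-- If the first step is at most `-y` with positive probability, then the supremum `W` of the
partial sums is almost surely infinite. Otherwise let `k` be least such that `W ≤ k * y` has positive
probability: the supremum after the first step has the law of `W` and is independent of that step,
so that with positive probability it is at most `k * y` while the step is at most `-y`; but then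
`W ≤ (k - 1) * y`, or `W < 0` if `k = 0`. -/
lemma ae_supSum_eq_top (hY : ∀ i, Measurable (Y i))
    (hlaw : IdentDistrib (fun ω i => Y i ω) (fun ω i => Y (i + 1) ω) Q Q)
    (hind : IndepFun (Y 0) (fun ω i => Y (i + 1) ω) Q)
    (hint : Integrable (Y 0) Q) (hmean : ∫ ω, Y 0 ω ∂Q = 0)
    {y : ℝ} (hy : 0 < y) (hneg : Q {ω | Y 0 ω ≤ -y} ≠ 0) :
    ∀ᵐ ω ∂Q, supSum (fun i => Y i ω) = ∞ := by
  set W : Ω → ℝ≥0∞ := fun ω => supSum fun i => Y i ω with hW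
  set W' : Ω → ℝ≥0∞ := fun ω => supSum fun i => Y (i + 1) ω with hW'
  have hWlaw : IdentDistrib W W' Q Q := hlaw.comp measurable_supSum
  have hae := ae_toReal_supSum_eq hY hlaw hind hint hmean
  set lvl : ℕ → ℝ≥0∞ := fun k => ENNReal.ofReal (k * y) with hlvl
  have hstep : ∀ k, Q {ω | W ω ≤ lvl k} ≠ 0 →
      Q ({ω | Y 0 ω ≤ -y} ∩ {ω | W' ω ≤ lvl k}) ≠ 0 := by
    intro k hk
    have h1 : Q {ω | W' ω ≤ lvl k} = Q {ω | W ω ≤ lvl k} :=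
      (hWlaw.measure_mem_eq (measurableSet_Iic (a := lvl k))).symm
    have hI : IndepFun (Y 0) W' Q := hind.comp measurable_id measurable_supSum
    have h2 := hI.measure_inter_preimage_eq_mul (Set.Iic (-y)) (Set.Iic (lvl k))
      measurableSet_Iic measurableSet_Iic
    change Q (Y 0 ⁻¹' Set.Iic (-y) ∩ W' ⁻¹' Set.Iic (lvl k)) ≠ 0
    rw [h2]
    exact mul_ne_zero hneg (by change Q {ω | W' ω ≤ lvl k} ≠ 0; rwa [h1])
  have key : ∀ ω, (W' ω ≠ ∞ → W ω ≠ ∞ ∧ (W ω).toReal = Y 0 ω + (W' ω).toReal) → ∀ k : ℕ,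
      Y 0 ω ≤ -y → W' ω ≤ lvl k → W ω ≠ ∞ ∧ (W ω).toReal ≤ k * y - y := by
    intro ω hω k h1 h2
    obtain ⟨h3, h4⟩ := hω (ne_top_of_le_ne_top ENNReal.ofReal_ne_top h2)
    have h5 : (W' ω).toReal ≤ k * y := ENNReal.toReal_le_of_le_ofReal (by positivity) h2
    exact ⟨h3, by linarith⟩
  have hzero : ∀ k, Q {ω | W ω ≤ lvl k} = 0 := by
    intro k
    induction k with
    | zero =>
      by_contra h
      refine hstep 0 h (measure_mono_null ?_ hae)
      rintro ω ⟨h1, h2⟩ hω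
      have := (key ω hω 0 h1 h2).2
      have h0 : 0 ≤ (W ω).toReal := ENNReal.toReal_nonneg
      push_cast at this
      linarith
    | succ k ih =>
      by_contra h
      refine hstep (k + 1) h (measure_mono_null ?_ (measure_union_null ih hae))
      rintro ω ⟨h1, h2⟩
      by_cases hω : W' ω ≠ ∞ → W ω ≠ ∞ ∧ (W ω).toReal = Y 0 ω + (W' ω).toReal
      · left
        obtain ⟨h3, h4⟩ := key ω hω (k + 1) h1 h2
        refine (ENNReal.le_ofReal_iff_toReal_le h3 (by positivity)).2 ?_
        push_cast at h4
        linarith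
      · exact Or.inr hω
  have : ∀ᵐ ω ∂Q, ∀ k, ¬ W ω ≤ lvl k :=
    ae_all_iff.2 fun k => by simpa [ae_iff] using hzero k
  filter_upwards [this] with ω hω
  by_contra h
  obtain ⟨k, hk⟩ := exists_nat_ge ((W ω).toReal / y)
  refine hω k ((ENNReal.le_ofReal_iff_toReal_le h (by positivity)).2 ?_)
  rwa [div_le_iff₀ hy] at hk

/-- The partial sums of a centred random walk whose steps are not almost surely zero are almost
surely unbounded above. -/
lemma ae_unbounded_sum (hY : ∀ i, Measurable (Y i))
    (hlaw : IdentDistrib (fun ω i => Y i ω) (fun ω i => Y (i + 1) ω) Q Q)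
    (hind : IndepFun (Y 0) (fun ω i => Y (i + 1) ω) Q)
    (hint : Integrable (Y 0) Q) (hmean : ∫ ω, Y 0 ω ∂Q = 0) (hne : ¬ Y 0 =ᵐ[Q] 0) :
    ∀ᵐ ω ∂Q, ∀ C : ℝ, ∃ n : ℕ, C < ∑ i ∈ Finset.range n, Y i ω := by
  have hneg : ∃ k : ℕ, Q {ω | Y 0 ω ≤ -(1 / ((k : ℝ) + 1))} ≠ 0 := by
    by_contra! hall
    have h0 : 0 ≤ᵐ[Q] Y 0 := by
      have : ∀ᵐ ω ∂Q, ∀ k : ℕ, ¬ Y 0 ω ≤ -(1 / ((k : ℝ) + 1)) :=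
        ae_all_iff.2 fun k => by simpa [ae_iff] using hall k
      filter_upwards [this] with ω hω
      by_contra h
      obtain ⟨k, hk⟩ := exists_nat_one_div_lt (neg_pos.2 (not_le.1 h))
      exact hω k (by linarith)
    exact hne ((integral_eq_zero_iff_of_nonneg_ae h0 hint).1 hmean)
  obtain ⟨k, hk⟩ := hneg
  filter_upwards [ae_supSum_eq_top hY hlaw hind hint hmean (by positivity) hk] with ω hω C
  by_contra! h
  refine ENNReal.ofReal_ne_top (r := C) (top_le_iff.1 (hω ▸ iSup_le fun n => ?_))
  exact ENNReal.ofReal_le_ofReal (h n)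

end Walk

/-! ### Alternating independent run lengths -/

section Alternating

variable {Ω : Type*} [MeasurableSpace Ω] {Q : Measure Ω} [IsProbabilityMeasure Q]
  {T : ℕ → Ω → ℕ} (hT : ∀ j, Measurable (T j)) (hind : iIndepFun T Q)

include hT hind

/-- Dropping the first pair of runs does not change the law of the run lengths. -/
lemma identDistrib_shift_two (hlaw : ∀ j, Q.map (T (j + 2)) = Q.map (T j)) :
    IdentDistrib (fun ω j => T j ω) (fun ω j => T (j + 2) ω) Q Q := by
  refine ⟨(measurable_pi_lambda _ hT).aemeasurable,
    (measurable_pi_lambda _ fun j => hT (j + 2)).aemeasurable, ?_⟩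
  have := fun j => Measure.isProbabilityMeasure_map (μ := Q) (hT j).aemeasurable
  have h2 : iIndepFun (fun j => T (j + 2)) Q := hind.precomp (add_left_injective 2)
  rw [hind.map_fun_eq_infinitePi_map hT, h2.map_fun_eq_infinitePi_map fun j => hT (j + 2)]
  simp_rw [hlaw]

omit [IsProbabilityMeasure Q] in
lemma indepFun_first_two :
    IndepFun (fun ω => (T 0 ω, T 1 ω)) (fun ω j => T (j + 2) ω) Q := by
  have h := indep_iSup_of_disjoint (m := fun j => MeasurableSpace.comap (T j) inferInstance)
    (fun j => (hT j).comap_le) hind.iIndep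
    (S := {j | j < 2}) (T := {j | 2 ≤ j}) (Set.disjoint_left.2 fun j h1 h2 => by
      simp only [Set.mem_ofPred_eq] at h1 h2; omega)
  have hmeas : ∀ (S : Set ℕ) (j : ℕ), j ∈ S →
      Measurable[⨆ i ∈ S, MeasurableSpace.comap (T i) inferInstance] (T j) := fun S j hj =>
    Measurable.of_comap_le (le_iSup₂_of_le j hj le_rfl)
  rw [IndepFun_iff_Indep]
  refine indep_of_indep_of_le_left (indep_of_indep_of_le_right h ?_) ?_
  · refine Measurable.comap_le ?_
    exact @measurable_pi_lambda _ _ _ (_) _ _ fun j => hmeas _ (j + 2) (by simp)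
  · refine Measurable.comap_le ?_
    exact @Measurable.prodMk _ _ _ _ _ (_) _ _ (hmeas _ 0 (by simp)) (hmeas _ 1 (by simp))

omit hT in
/-- Two independent integer variables which are almost surely equal are constant. -/
lemma exists_ae_eq_const_of_ae_eq (h : ∀ᵐ ω ∂Q, T 1 ω = T 0 ω) :
    ∃ a, (∀ᵐ ω ∂Q, T 0 ω = a) ∧ ∀ᵐ ω ∂Q, T 1 ω = a := by
  obtain ⟨a, ha⟩ : ∃ a, Q {ω | T 0 ω = a} ≠ 0 := by
    by_contra! hall
    have : ∀ᵐ ω ∂Q, ∀ a, T 0 ω ≠ a := ae_all_iff.2 fun a => by simpa [ae_iff] using hall a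
    obtain ⟨ω, hω⟩ := this.exists
    exact hω _ rfl
  have h1 : ∀ᵐ ω ∂Q, T 1 ω = a := by
    have hmul := (hind.indepFun zero_ne_one).measure_inter_preimage_eq_mul {a} {a}ᶜ
      (measurableSet_singleton a) (measurableSet_singleton a).compl
    have hz : Q (T 0 ⁻¹' {a} ∩ T 1 ⁻¹' {a}ᶜ) = 0 := by
      refine measure_mono_null ?_ h
      rintro ω ⟨h1, h2⟩ h3
      exact h2 (h3.trans h1)
    rw [hz, eq_comm, mul_eq_zero] at hmul
    exact hmul.resolve_left ha
  refine ⟨a, ?_, h1⟩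
  filter_upwards [h, h1] with ω h2 h3
  rw [← h2, h3]

/-- If the lengths of the runs of either letter have the same finite mean, and are not all equal to
the same constant, then the sums of their differences are unbounded in both directions. -/
lemma ae_unbounded_sum_sub (hlaw : ∀ j, Q.map (T (j + 2)) = Q.map (T j))
    (h0 : ∫⁻ ω, (T 0 ω : ℝ≥0∞) ∂Q ≠ ∞)
    (h01 : ∫⁻ ω, (T 1 ω : ℝ≥0∞) ∂Q = ∫⁻ ω, (T 0 ω : ℝ≥0∞) ∂Q)
    (hne : ¬ ∃ a, (∀ᵐ ω ∂Q, T 0 ω = a) ∧ ∀ᵐ ω ∂Q, T 1 ω = a) :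
    ∀ᵐ ω ∂Q, (∀ C : ℝ, ∃ n : ℕ, C < ∑ i ∈ Finset.range n, ((T (2 * i + 1) ω : ℝ) - T (2 * i) ω)) ∧
      ∀ C : ℝ, ∃ n : ℕ, ∑ i ∈ Finset.range n, ((T (2 * i + 1) ω : ℝ) - T (2 * i) ω) < C := by
  have hcast : ∀ j, Measurable fun ω => (T j ω : ℝ) := fun j => measurable_from_top.comp (hT j)
  have hint0 : Integrable (fun ω => (T 0 ω : ℝ)) Q := integrable_natCast (hT 0) h0
  have hint1 : Integrable (fun ω => (T 1 ω : ℝ)) Q :=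
    integrable_natCast (X := fun _ => T 1) (hT 1) (h01 ▸ h0)
  have hmean : ∫ ω, ((T 1 ω : ℝ) - T 0 ω) ∂Q = 0 := by
    rw [integral_sub hint1 hint0, integral_natCast (X := fun _ => T 1) (hT 1),
      integral_natCast (hT 0), h01, sub_self]
  have hnez : ¬ ∀ᵐ ω ∂Q, (T 1 ω : ℝ) - T 0 ω = 0 := fun h =>
    hne (exists_ae_eq_const_of_ae_eq hind (h.mono fun ω hω => by
      exact_mod_cast sub_eq_zero.1 hω))
  -- both differences are functions `ψ` of two successive run lengths
  have main : ∀ ψ : ℕ → ℕ → ℝ, Integrable (fun ω => ψ (T 0 ω) (T 1 ω)) Q →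
      ∫ ω, ψ (T 0 ω) (T 1 ω) ∂Q = 0 → (¬ ∀ᵐ ω ∂Q, ψ (T 0 ω) (T 1 ω) = 0) →
      ∀ᵐ ω ∂Q, ∀ C : ℝ, ∃ n : ℕ,
        C < ∑ i ∈ Finset.range n, ψ (T (2 * i) ω) (T (2 * i + 1) ω) := by
    intro ψ hψ1 hψ2 hψ3
    have hψm : Measurable fun p : ℕ × ℕ => ψ p.1 p.2 := measurable_of_countable _
    have hΨ : Measurable fun (t : ℕ → ℕ) (i : ℕ) => ψ (t (2 * i)) (t (2 * i + 1)) :=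
      measurable_pi_lambda _ fun i => hψm.comp (g := fun p : ℕ × ℕ => ψ p.1 p.2)
        (f := fun t : ℕ → ℕ => (t (2 * i), t (2 * i + 1)))
        ((measurable_pi_apply (2 * i)).prodMk (measurable_pi_apply (2 * i + 1)))
    refine ae_unbounded_sum (Y := fun i ω => ψ (T (2 * i) ω) (T (2 * i + 1) ω)) (fun i => ?_)
      ?_ ?_ hψ1 hψ2 hψ3
    · exact hψm.comp ((hT (2 * i)).prodMk (hT (2 * i + 1)))
    · exact (identDistrib_shift_two hT hind hlaw).comp hΨ
    · exact (indepFun_first_two hT hind).comp hψm hΨ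
  have hup := main (fun a b => (b : ℝ) - a) (hint1.sub hint0) hmean hnez
  have hdown := main (fun a b => (a : ℝ) - b) (hint0.sub hint1)
    (by rw [← neg_zero, ← hmean, ← integral_neg]; simp)
    (fun h => hnez (h.mono fun ω hω => by linarith))
  filter_upwards [hup, hdown] with ω h1 h2
  refine ⟨h1, fun C => ?_⟩
  obtain ⟨n, hn⟩ := h2 (-C)
  refine ⟨n, ?_⟩
  have : ∑ i ∈ Finset.range n, ((T (2 * i + 1) ω : ℝ) - T (2 * i) ω) =
      -∑ i ∈ Finset.range n, ((T (2 * i) ω : ℝ) - T (2 * i + 1) ω) := by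
    rw [← Finset.sum_neg_distrib]
    exact Finset.sum_congr rfl fun i _ => by ring
  linarith

end Alternating

/-! ### Recurrence and transience along a path -/

/-- A sequence of integers without upward jumps larger than `1` and without downward jumps larger
than `1`, unbounded in both directions, takes every value infinitely often. -/
lemma frequently_eq_of_unbounded {S : ℕ → ℤ} (hup : ∀ n, S (n + 1) ≤ S n + 1)
    (hdown : ∀ n, S n ≤ S (n + 1) + 1) (habove : ∀ C, ∃ n, C < S n) (hbelow : ∀ C, ∃ n, S n < C)
    (x : ℤ) : ∃ᶠ n in atTop, S n = x := by
  have hle : ∀ n, S n ≤ S 0 + n := fun n => by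
    induction n with
    | zero => simp
    | succ n ih => have := hup n; push_cast; omega
  have hge : ∀ n, S 0 - n ≤ S n := fun n => by
    induction n with
    | zero => simp
    | succ n ih => have := hdown n; push_cast; omega
  refine frequently_atTop.2 fun N => ?_
  obtain ⟨n, hn⟩ := habove (max x (S 0 + N))
  have hNn : N ≤ n := by have := hle n; omega
  have hm : ∃ m, n ≤ m ∧ S m ≤ x := by
    obtain ⟨m, hm⟩ := hbelow (min x (S 0 - n))
    exact ⟨m, by have := hge m; omega, by omega⟩
  classical
  obtain ⟨h1, h2⟩ := Nat.find_spec hm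
  refine ⟨Nat.find hm, hNn.trans h1, le_antisymm h2 ?_⟩
  rcases hk : Nat.find hm with _ | k
  · rw [hk] at h1 h2
    obtain rfl : n = 0 := by omega
    omega
  · rcases h1.eq_or_lt with h | h
    · rw [← hk, ← h]; omega
    · have := Nat.find_min hm (show k < Nat.find hm by omega)
      have hkn : n ≤ k := by omega
      have hx : ¬ S k ≤ x := fun hx => this ⟨hkn, hx⟩
      have := hdown k
      omega

lemma tendsto_abs_atTop_of_tendsto_div {S : ℕ → ℤ} {v : ℝ} (hv : v ≠ 0)
    (h : Tendsto (fun n : ℕ => (S n : ℝ) / n) atTop (𝓝 v)) :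
    Tendsto (fun n => |S n|) atTop atTop := by
  have h1 := h.abs.pos_mul_atTop (abs_pos.2 hv) tendsto_natCast_atTop_atTop
  refine (tendsto_intCast_atTop_iff (R := ℝ)).1 (h1.congr' ?_)
  filter_upwards [eventually_gt_atTop 0] with n hn
  have : (0 : ℝ) < n := by exact_mod_cast hn
  rw [abs_div, abs_of_pos this, div_mul_cancel₀ _ this.ne']
  push_cast; rfl

lemma walk_eq {Ω : Type*} (U : ℕ → Ω → LeftWord) (n : ℕ) (ω : Ω) :
    walk U n ω = (letterCount (fun n => letter U n ω) u n : ℤ) -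
      letterCount (fun n => letter U n ω) d n :=
  sum_jump (fun n => letter U n ω) n

lemma drift_mem_Icc (α : Letter → ℕ∞ → ℝ) : drift α ∈ Set.Icc (-1 : ℝ) 1 := by
  rw [drift]
  split_ifs with h1 h2
  · norm_num
  · norm_num
  · have hu := ENNReal.toReal_mono h1 (one_le_meanRun α u)
    have hd := ENNReal.toReal_mono h2 (one_le_meanRun α d)
    rw [ENNReal.toReal_one] at hu hd
    constructor
    · rw [le_div_iff₀ (by linarith)]; linarith
    · rw [div_le_iff₀ (by linarith)]; linarith

section Main

variable {Ω : Type*} [MeasurableSpace Ω] {P : Measure Ω} {α : Letter → ℕ∞ → ℝ}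
  {U : ℕ → Ω → LeftWord}

lemma IsVLMC.measurable_runLen (hU : IsVLMC α P U) (j : ℕ) :
    Measurable fun ω => runLen (fun n => letter U n ω) j :=
  (PersistentWalk.measurable_runLen j).comp hU.measurable_letter

variable [IsProbabilityMeasure P]

/-- Given that an up-down breaking time occurs at time `0`, the lengths of the successive runs are
independent, alternately distributed as the lengths of the runs of descents and of rises. -/
lemma IsVLMC.runLen_indep (hU : IsVLMC α P U)
    (hα : ∀ l : Letter, ∀ n : ℕ∞, 1 ≤ n → α l n ∈ Set.Icc (0 : ℝ) 1)
    (hadm : Admissible α) (hpos : P (upDownAtZero U) ≠ 0) :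
    iIndepFun (fun j ω => runLen (fun n => letter U n ω) j) (cond P (upDownAtZero U)) ∧
      ∀ j, (cond P (upDownAtZero U)).map (fun ω => runLen (fun n => letter U n ω) j) =
        runLaw α (runLetter j) := by
  have := isProbabilityMeasure_runLaw hα hadm
  have hQ : IsProbabilityMeasure (cond P (upDownAtZero U)) := cond_isProbabilityMeasure hpos
  have hT := hU.measurable_runLen
  have hmap := hU.map_runLen hα hadm hpos
  have hlaw : ∀ j, (cond P (upDownAtZero U)).map (fun ω => runLen (fun n => letter U n ω) j) =
      runLaw α (runLetter j) := by
    intro j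
    rw [← Measure.infinitePi_map_eval (fun j => runLaw α (runLetter j)) j, ← hmap,
      Measure.map_map (measurable_pi_apply j) (measurable_pi_lambda _ hT)]
    rfl
  refine ⟨(iIndepFun_iff_map_fun_eq_infinitePi_map hT).2 ?_, hlaw⟩
  rw [hmap]
  simp_rw [hlaw]

lemma IsVLMC.ae_runs (hU : IsVLMC α P U)
    (hα : ∀ l : Letter, ∀ n : ℕ∞, 1 ≤ n → α l n ∈ Set.Icc (0 : ℝ) 1)
    (hadm : Admissible α) (hpos : P (upDownAtZero U) ≠ 0) :
    ∀ᵐ ω ∂(cond P (upDownAtZero U)), letter U 1 ω = d ∧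
      ∀ j, runLen (fun n => letter U n ω) j ≠ 0 := by
  have hlaw := (hU.runLen_indep hα hadm hpos).2
  have h1 : ∀ᵐ ω ∂(cond P (upDownAtZero U)), ∀ j, runLen (fun n => letter U n ω) j ≠ 0 := by
    refine ae_all_iff.2 fun j => ?_
    have hm := hU.measurable_runLen j
    have h0 : (cond P (upDownAtZero U)).map
        (fun ω => runLen (fun n => letter U n ω) j) {0} = 0 := by
      rw [hlaw, runLaw_singleton, runProb_zero, ENNReal.ofReal_zero]
    rw [Measure.map_apply hm (measurableSet_singleton 0)] at h0
    exact compl_mem_ae_iff.2 h0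
  filter_upwards [h1, ae_cond_mem hU.measurableSet_upDownAtZero] with ω h2 h3
  exact ⟨h3.2, h2⟩

lemma IsVLMC.lintegral_runLen (hU : IsVLMC α P U)
    (hα : ∀ l : Letter, ∀ n : ℕ∞, 1 ≤ n → α l n ∈ Set.Icc (0 : ℝ) 1)
    (hadm : Admissible α) (hpos : P (upDownAtZero U) ≠ 0) (j : ℕ) :
    ∫⁻ ω, (runLen (fun n => letter U n ω) j : ℝ≥0∞) ∂(cond P (upDownAtZero U)) =
      meanRun α (runLetter j) := by
  rw [← lintegral_runLaw hα hadm, ← (hU.runLen_indep hα hadm hpos).2 j,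
    lintegral_map measurable_from_top (hU.measurable_runLen j)]

/-- The law of large numbers for the lengths of the runs `b, b + 2, b + 4, …`. -/
lemma IsVLMC.strong_law_runLen (hU : IsVLMC α P U)
    (hα : ∀ l : Letter, ∀ n : ℕ∞, 1 ≤ n → α l n ∈ Set.Icc (0 : ℝ) 1)
    (hadm : Admissible α) (hpos : P (upDownAtZero U) ≠ 0) (b : ℕ) :
    ∀ᵐ ω ∂(cond P (upDownAtZero U)),
      (meanRun α (runLetter b) ≠ ∞ → Tendsto (fun j : ℕ =>
        ((∑ i ∈ Finset.range j, runLen (fun n => letter U n ω) (2 * i + b) : ℕ) : ℝ) / j) atTop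
          (𝓝 (meanRun α (runLetter b)).toReal)) ∧
      (meanRun α (runLetter b) = ∞ → Tendsto (fun j : ℕ =>
        ((∑ i ∈ Finset.range j, runLen (fun n => letter U n ω) (2 * i + b) : ℕ) : ℝ) / j) atTop
          atTop) := by
  have hQ : IsProbabilityMeasure (cond P (upDownAtZero U)) := cond_isProbabilityMeasure hpos
  obtain ⟨hind, hlaw⟩ := hU.runLen_indep hα hadm hpos
  have hT := hU.measurable_runLen
  have hpair : Pairwise fun i j => IndepFun (fun ω => runLen (fun n => letter U n ω) (2 * i + b))
      (fun ω => runLen (fun n => letter U n ω) (2 * j + b)) (cond P (upDownAtZero U)) :=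
    fun i j hij => hind.indepFun (by omega)
  have hid : ∀ j, IdentDistrib (fun ω => runLen (fun n => letter U n ω) (2 * j + b))
      (fun ω => runLen (fun n => letter U n ω) (2 * 0 + b)) (cond P (upDownAtZero U))
      (cond P (upDownAtZero U)) := fun j =>
    ⟨(hT _).aemeasurable, (hT _).aemeasurable, by
      rw [hlaw, hlaw]; simp [runLetter, Nat.bodd_add]⟩
  have hmean := hU.lintegral_runLen hα hadm hpos (2 * 0 + b)
  rw [show runLetter (2 * 0 + b) = runLetter b by simp] at hmean
  by_cases hfin : meanRun α (runLetter b) = ∞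
  · have := strong_law_natCast_top (X := fun i ω => runLen (fun n => letter U n ω) (2 * i + b))
      (fun j => hT _) hpair hid (hmean.trans hfin)
    filter_upwards [this] with ω hω
    exact ⟨fun h => absurd hfin h, fun _ => hω⟩
  · have := strong_law_natCast (X := fun i ω => runLen (fun n => letter U n ω) (2 * i + b))
      (fun j => hT _) hpair hid (hmean ▸ hfin)
    rw [hmean] at this
    filter_upwards [this] with ω hω
    exact ⟨fun _ => hω, fun h => absurd h hfin⟩

/-- The strong law for the walk. The ratio `S n / n` is `1 - 2 c / n` where `c` is the
number of descents, or `2 c / n - 1` where `c` is the number of rises; the letter with runs of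
finite mean is the one to count. -/
lemma IsVLMC.tendsto_walk_div (hU : IsVLMC α P U)
    (hα : ∀ l : Letter, ∀ n : ℕ∞, 1 ≤ n → α l n ∈ Set.Icc (0 : ℝ) 1)
    (hadm : Admissible α) (hpos : P (upDownAtZero U) ≠ 0)
    (hmean : meanRun α u ≠ ∞ ∨ meanRun α d ≠ ∞) :
    ∀ᵐ ω ∂(cond P (upDownAtZero U)),
      Tendsto (fun n : ℕ => (walk U n ω : ℝ) / (n : ℝ)) atTop (𝓝 (drift α)) := by
  filter_upwards [hU.ae_runs hα hadm hpos, hU.strong_law_runLen hα hadm hpos 0,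
    hU.strong_law_runLen hα hadm hpos 1] with ω hruns hd hu
  obtain ⟨hx, hne⟩ := hruns
  set x : ℕ → Letter := fun n => letter U n ω with hxdef
  have hB := strictMono_pairEnd (x := x) hne
  have hcd : ∀ j, letterCount x d (pairEnd x j) = ∑ i ∈ Finset.range j, runLen x (2 * i + 0) :=
    letterCount_d_pairEnd hx hne
  have hcu : ∀ j, letterCount x u (pairEnd x j) = ∑ i ∈ Finset.range j, runLen x (2 * i + 1) :=
    letterCount_u_pairEnd hx hne
  have hBsum : ∀ j : ℕ, (pairEnd x j : ℝ) / j =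
      (letterCount x u (pairEnd x j) : ℝ) / j + (letterCount x d (pairEnd x j) : ℝ) / j := by
    intro j
    rw [← add_div]
    congr 1
    exact_mod_cast (letterCount_add x (pairEnd x j)).symm
  simp_rw [← hcd] at hd
  simp_rw [← hcu] at hu
  have hd : (meanRun α d ≠ ∞ → Tendsto (fun j : ℕ => (letterCount x d (pairEnd x j) : ℝ) / j) atTop
      (𝓝 (meanRun α d).toReal)) ∧ (meanRun α d = ∞ →
        Tendsto (fun j : ℕ => (letterCount x d (pairEnd x j) : ℝ) / j) atTop atTop) := hd
  have hu : (meanRun α u ≠ ∞ → Tendsto (fun j : ℕ => (letterCount x u (pairEnd x j) : ℝ) / j) atTop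
      (𝓝 (meanRun α u).toReal)) ∧ (meanRun α u = ∞ →
        Tendsto (fun j : ℕ => (letterCount x u (pairEnd x j) : ℝ) / j) atTop atTop) := hu
  have hwalk_d : ∀ᶠ n : ℕ in atTop,
      1 - 2 * ((letterCount x d n : ℝ) / n) = (walk U n ω : ℝ) / n := by
    filter_upwards [eventually_gt_atTop 0] with n hn
    have hn' : (n : ℝ) ≠ 0 := by positivity
    have h1 : (letterCount x u n : ℝ) + letterCount x d n = n := by
      exact_mod_cast letterCount_add x n
    rw [walk_eq]
    push_cast
    rw [eq_div_iff hn', sub_mul, mul_assoc, div_mul_cancel₀ _ hn']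
    linarith
  have hwalk_u : ∀ᶠ n : ℕ in atTop,
      2 * ((letterCount x u n : ℝ) / n) - 1 = (walk U n ω : ℝ) / n := by
    filter_upwards [eventually_gt_atTop 0] with n hn
    have hn' : (n : ℝ) ≠ 0 := by positivity
    have h1 : (letterCount x u n : ℝ) + letterCount x d n = n := by
      exact_mod_cast letterCount_add x n
    rw [walk_eq]
    push_cast
    rw [eq_div_iff hn', sub_mul, mul_assoc, div_mul_cancel₀ _ hn']
    linarith
  have hinv : ∀ j : ℕ, ((pairEnd x j : ℝ) / j)⁻¹ = j / pairEnd x j := fun j => inv_div _ _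
  by_cases hutop : meanRun α u = ∞
  · have hdfin : meanRun α d ≠ ∞ := hmean.resolve_left (not_not.2 hutop)
    have hBt : Tendsto (fun j : ℕ => (pairEnd x j : ℝ) / j) atTop atTop := by
      simp_rw [hBsum]
      exact (hu.2 hutop).atTop_add (hd.1 hdfin)
    have hr := hBt.inv_tendsto_atTop
    simp only [Pi.inv_def, hinv] at hr
    have h1 := tendsto_div_of_subseq (monotone_letterCount x d) hB rfl (hd.1 hdfin) hr
    have h2 := ((h1.const_mul 2).const_sub 1).congr' hwalk_d
    simpa [drift, hutop] using h2
  by_cases hdtop : meanRun α d = ∞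
  · have hBt : Tendsto (fun j : ℕ => (pairEnd x j : ℝ) / j) atTop atTop := by
      simp_rw [hBsum]
      exact (hu.1 hutop).add_atTop (hd.2 hdtop)
    have hr := hBt.inv_tendsto_atTop
    simp only [Pi.inv_def, hinv] at hr
    have h1 := tendsto_div_of_subseq (monotone_letterCount x u) hB rfl (hu.1 hutop) hr
    have h2 := ((h1.const_mul 2).sub_const 1).congr' hwalk_u
    simpa [drift, hutop, hdtop] using h2
  · have hu1 := ENNReal.toReal_mono hutop (one_le_meanRun α u)
    have hd1 := ENNReal.toReal_mono hdtop (one_le_meanRun α d)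
    rw [ENNReal.toReal_one] at hu1 hd1
    have hpos' : (meanRun α u).toReal + (meanRun α d).toReal ≠ 0 := by positivity
    have hBt : Tendsto (fun j : ℕ => (pairEnd x j : ℝ) / j) atTop
        (𝓝 ((meanRun α u).toReal + (meanRun α d).toReal)) := by
      simp_rw [hBsum]
      exact (hu.1 hutop).add (hd.1 hdtop)
    have hr := hBt.inv₀ hpos'
    simp only [hinv] at hr
    have h1 := tendsto_div_of_subseq (monotone_letterCount x d) hB rfl (hd.1 hdtop) hr
    have h2 := ((h1.const_mul 2).const_sub 1).congr' hwalk_d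
    have h3 : drift α = 1 - 2 * ((meanRun α d).toReal *
        ((meanRun α u).toReal + (meanRun α d).toReal)⁻¹) := by
      rw [drift, if_neg hutop, if_neg hdtop]
      field_simp
      ring
    rwa [h3]

lemma IsVLMC.recurrent_of_drift_eq_zero (hU : IsVLMC α P U)
    (hα : ∀ l : Letter, ∀ n : ℕ∞, 1 ≤ n → α l n ∈ Set.Icc (0 : ℝ) 1)
    (hadm : Admissible α) (hconst : ¬ (ConstantRun α u ∧ ConstantRun α d))
    (hpos : P (upDownAtZero U) ≠ 0) (h0 : drift α = 0) :
    Recurrent (cond P (upDownAtZero U)) (walk U) := by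
  have hutop : meanRun α u ≠ ∞ := fun h => by simp [drift, h] at h0
  have hdtop : meanRun α d ≠ ∞ := fun h => by simp [drift, h, hutop] at h0
  have heq : meanRun α u = meanRun α d := by
    have hu1 := ENNReal.toReal_mono hutop (one_le_meanRun α u)
    have hd1 := ENNReal.toReal_mono hdtop (one_le_meanRun α d)
    rw [ENNReal.toReal_one] at hu1 hd1
    rw [drift, if_neg hutop, if_neg hdtop, div_eq_zero_iff] at h0
    refine (ENNReal.toReal_eq_toReal_iff' hutop hdtop).1 ?_
    rcases h0 with h | h <;> linarith
  have hQ : IsProbabilityMeasure (cond P (upDownAtZero U)) := cond_isProbabilityMeasure hpos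
  obtain ⟨hind, hlaw⟩ := hU.runLen_indep hα hadm hpos
  have hT := hU.measurable_runLen
  have hl0 := hU.lintegral_runLen hα hadm hpos 0
  have hl1 := hU.lintegral_runLen hα hadm hpos 1
  have hunb := ae_unbounded_sum_sub hT hind
    (fun j => by rw [hlaw, hlaw]; simp [runLetter])
    (by rw [hl0]; exact hdtop) (by rw [hl0, hl1]; exact heq) (by
      rintro ⟨a, ha0, ha1⟩
      have hc : ∀ j, (∀ᵐ ω ∂(cond P (upDownAtZero U)),
          runLen (fun n => letter U n ω) j = a) → ConstantRun α (runLetter j) := by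
        intro j hj
        refine constantRun_of_ae_eq hα hadm _ a ?_
        rw [← hlaw j]
        exact (ae_map_iff (hT j).aemeasurable (measurableSet_singleton a)).2 hj
      exact hconst ⟨hc 1 ha1, hc 0 ha0⟩)
  intro y
  filter_upwards [hunb, hU.ae_runs hα hadm hpos] with ω h hruns
  obtain ⟨hx, hne⟩ := hruns
  have hS : ∀ j, (walk U (pairEnd (fun n => letter U n ω) j) ω : ℝ) = ∑ i ∈ Finset.range j,
      ((runLen (fun n => letter U n ω) (2 * i + 1) : ℝ) -
        runLen (fun n => letter U n ω) (2 * i)) := by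
    intro j
    rw [walk_eq, letterCount_u_pairEnd hx hne, letterCount_d_pairEnd hx hne]
    push_cast
    rw [Finset.sum_sub_distrib]
  have hstep : ∀ n, walk U (n + 1) ω = walk U n ω + jump (letter U (n + 1) ω) := fun n =>
    Finset.sum_Icc_succ_top (by omega) _
  have hjump : ∀ l, -1 ≤ jump l ∧ jump l ≤ 1 := by
    intro l; rcases l <;> simp [jump]
  refine frequently_eq_of_unbounded (fun n => ?_) (fun n => ?_) (fun C => ?_) (fun C => ?_) y
  · have := hjump (letter U (n + 1) ω); have := hstep n; omega
  · have := hjump (letter U (n + 1) ω); have := hstep n; omega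
  · obtain ⟨j, hj⟩ := h.1 C
    rw [← hS] at hj
    exact ⟨_, by exact_mod_cast hj⟩
  · obtain ⟨j, hj⟩ := h.2 C
    rw [← hS] at hj
    exact ⟨_, by exact_mod_cast hj⟩

end Main

lemma not_transient_of_recurrent {Ω : Type*} [MeasurableSpace Ω] {Q : Measure Ω}
    [IsProbabilityMeasure Q] {S : ℕ → Ω → ℤ} (hr : Recurrent Q S) : ¬ Transient Q S := by
  intro ht
  obtain ⟨ω, h1, h2⟩ := ((hr 0).and ht).exists
  obtain ⟨n, h3, h4⟩ := (h1.and_eventually (h2.eventually_ge_atTop 1)).exists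
  simp [h3] at h4

end PersistentWalk

theorem proposition3p1 {Ω : Type*} [MeasurableSpace Ω] (P : Measure Ω) [IsProbabilityMeasure P]
    (α : PersistentWalk.Letter → ℕ∞ → ℝ)
    (hα : ∀ l : PersistentWalk.Letter, ∀ n : ℕ∞, 1 ≤ n → α l n ∈ Set.Icc (0 : ℝ) 1)
    (hadm : PersistentWalk.Admissible α)
    (hconst : ¬ (PersistentWalk.ConstantRun α PersistentWalk.u ∧
      PersistentWalk.ConstantRun α PersistentWalk.d))
    (U : ℕ → Ω → PersistentWalk.LeftWord) (hU : PersistentWalk.IsVLMC α P U)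
    (hpos : P (PersistentWalk.upDownAtZero U) ≠ 0)
    (hmean : PersistentWalk.meanRun α PersistentWalk.u ≠ ∞ ∨
      PersistentWalk.meanRun α PersistentWalk.d ≠ ∞) :
    (PersistentWalk.Recurrent (ProbabilityTheory.cond P (PersistentWalk.upDownAtZero U))
        (PersistentWalk.walk U) ↔ PersistentWalk.drift α = 0) ∧
    (PersistentWalk.Transient (ProbabilityTheory.cond P (PersistentWalk.upDownAtZero U))
        (PersistentWalk.walk U) ↔ PersistentWalk.drift α ≠ 0) ∧
    PersistentWalk.drift α ∈ Set.Icc (-1 : ℝ) 1 ∧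
    (∀ᵐ ω ∂(ProbabilityTheory.cond P (PersistentWalk.upDownAtZero U)),
      Tendsto (fun n : ℕ => (PersistentWalk.walk U n ω : ℝ) / (n : ℝ)) atTop
        (𝓝 (PersistentWalk.drift α))) := by
  have hQ : IsProbabilityMeasure (ProbabilityTheory.cond P (PersistentWalk.upDownAtZero U)) :=
    cond_isProbabilityMeasure hpos
  have hlim := hU.tendsto_walk_div hα hadm hpos hmean
  have hrec := hU.recurrent_of_drift_eq_zero hα hadm hconst hpos
  have htrans : PersistentWalk.drift α ≠ 0 →
      PersistentWalk.Transient (ProbabilityTheory.cond P (PersistentWalk.upDownAtZero U))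
        (PersistentWalk.walk U) := fun h =>
    hlim.mono fun ω hω => PersistentWalk.tendsto_abs_atTop_of_tendsto_div h hω
  refine ⟨⟨fun hr => ?_, hrec⟩, ⟨fun ht h0 => ?_, htrans⟩, PersistentWalk.drift_mem_Icc α, hlim⟩
  · by_contra h
    exact PersistentWalk.not_transient_of_recurrent hr (htrans h)
  · exact PersistentWalk.not_transient_of_recurrent (hrec h0) ht
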